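/- Let $p\ge 1$ and let $X_{k,n}$ ($1\le k\le p$, $n\ge 1$) be the observations of $p$ independent data streams, all independent and normal with variance $1$. Under $\mathbb P_\infty$ all means are $0$; under $\mathbb P_{\mu,\nu}$, where $\mu=(\mu_1,\dots,\mu_p)\in\mathbb R^p$ and $1\le\nu<\infty$, the mean of $X_{k,n}$ is $0$ for $n<\nu$ and $\mu_k$ for $n\ge\nu$. Let $\mathcal F_n$ be the $\sigma$-algebra generated by $X_{k,i}$, $1\le k\le p$, $1\le i\le n$. For a random time $T$ with values in $\{0,1,2,\dots,\infty\}$ put $$D_\mu(T)=\sup_{1\le \nu<\infty}\operatorname{ess\,sup}\ \mathbb E_{\mu,\nu}\bigl(T-\nu+1\mid T\ge\nu,\ \mathcal F_{\nu-1}\bigr).$$ Fix $0\le c\le 1$ and $\omega\in\mathbb R^p$. Let $f_\theta$ be the $N(\theta,1)$ density and define $$\hat\mu_{k,m,\ell}=\omega_k+c\Bigl(\frac{X_{k,m}+\dots+X_{k,\ell-1}}{\ell-m}-\omega_k\Bigr)\ (\ell>m),\qquad \hat\mu_{k,m,m}=0,$$ $$\Lambda_{n,m}=\prod_{\ell=m}^n\prod_{k=1}^p\frac{f_{\hat\mu_{k,m,\ell}}(X_{k,\ell})}{f_0(X_{k,\ell})},\qquad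 N_B=\inf\Bigl\{n\ge1:\ \sum_{m=1}^n\Lambda_{n,m}\ge B\Bigr\}\quad(\inf\emptyset=\infty).$$ (i) For all $0<B<\infty$, $\ \mathbb E_\infty(N_B)\ge B$. (ii) Let $\mu\in\mathbb R^p$, $\mu^*_k=c\mu_k+(1-c)\omega_k$, and let $$I=I(\mu^*,0;\mu)=\mathbb E\sum_{k=1}^p\log\frac{f_{\mu^*_k}(Y_k)}{f_0(Y_k)}\ \Bigl(=\tfrac12\bigl[\|\mu\|^2-(1-c)^2\|\mu-\omega\|^2\bigr]\Bigr),$$ where $Y_1,\dots,Y_p$ are independent with $Y_k\sim N(\mu_k,1)$. If $I>0$, then, with $p,c,\omega,\mu$ fixed and $B\to\infty$, $$D_\mu(N_B)\le\frac{\log B+\frac{pc^2}{2}\log\log B-\frac{pc^2}{2}\log I}{I}+o(p\log\log B).$$ -/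

import Mathlib

open scoped ENNReal

namespace SRRS

noncomputable section

/-- The data of `p` streams: `x n k` is the observation `X_{k,n}` of stream `k` at time `n`.
Observation times are `n = 1, 2, …`; the entry `x 0` is padding that nothing below looks at. -/
abbrev Obs (p : ℕ) : Type := ℕ → Fin p → ℝ

/-- The σ-algebras `ℱ n` of all information up to time `n`, generated by the observations of all
streams at the times `1, …, n`; in particular `ℱ 0` is trivial. -/
def info (p : ℕ) : MeasureTheory.Filtration ℕ (inferInstance : MeasurableSpace (Obs p)) where
  seq n := ⨆ i ∈ Finset.Icc 1 n, MeasurableSpace.comap (fun x : Obs p => x i) inferInstance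
  mono' := fun _ _ h => biSup_mono fun _ hi =>
    Finset.mem_Icc.2 ⟨(Finset.mem_Icc.1 hi).1, (Finset.mem_Icc.1 hi).2.trans h⟩
  le' := fun _ => iSup₂_le fun i _ => (measurable_pi_apply i).comap_le

/-- The law of one observation vector: independent normal coordinates, the `k`-th with mean `m k`
and variance `1`. -/
def obsLaw {p : ℕ} (m : Fin p → ℝ) : MeasureTheory.Measure (Fin p → ℝ) :=
  MeasureTheory.Measure.pi fun k => ProbabilityTheory.gaussianReal (m k) 1

/-- `P_∞`: no change, all observations are independent `N(0,1)`. -/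
def lawNoChange (p : ℕ) : MeasureTheory.Measure (Obs p) :=
  MeasureTheory.Measure.infinitePi fun _ : ℕ => obsLaw (0 : Fin p → ℝ)

/-- `P_{μ,ν}`: all observations are independent with variance `1`; in stream `k` the mean is `0`
before time `ν` and `μ k` from time `ν` on. -/
def lawChange {p : ℕ} (μ : Fin p → ℝ) (ν : ℕ) : MeasureTheory.Measure (Obs p) :=
  MeasureTheory.Measure.infinitePi fun n : ℕ => obsLaw (if ν ≤ n then μ else 0)

/-- The linear shrinkage estimator `ω_k + c ((X_{k,m} + ⋯ + X_{k,ℓ-1}) / (ℓ - m) - ω_k)` for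
`ℓ > m`, and `0` for `ℓ = m`, when there is no observation to estimate from. -/
def estimate {p : ℕ} (c : ℝ) (ω : Fin p → ℝ) (x : Obs p) (k : Fin p) (m ℓ : ℕ) : ℝ :=
  if ℓ ≤ m then 0
  else ω k + c * ((∑ i ∈ Finset.Ico m ℓ, x i k) / ((ℓ : ℝ) - (m : ℝ)) - ω k)

/-- The plug-in likelihood ratio `Λ_{n,m}`. -/
def plugInLR {p : ℕ} (c : ℝ) (ω : Fin p → ℝ) (n m : ℕ) (x : Obs p) : ℝ :=
  ∏ ℓ ∈ Finset.Icc m n, ∏ k : Fin p,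
    ProbabilityTheory.gaussianPDFReal (estimate c ω x k m ℓ) 1 (x ℓ k) /
      ProbabilityTheory.gaussianPDFReal 0 1 (x ℓ k)

/-- The detection statistic `∑_{m=1}^n Λ_{n,m}`. -/
def statistic {p : ℕ} (c : ℝ) (ω : Fin p → ℝ) (n : ℕ) (x : Obs p) : ℝ :=
  ∑ m ∈ Finset.Icc 1 n, plugInLR c ω n m x

/-- The alarm time `N_B = inf {n ≥ 1 : ∑_{m=1}^n Λ_{n,m} ≥ B}`, which is `∞` if there is no such
`n`. -/
def alarmTime {p : ℕ} (c : ℝ) (ω : Fin p → ℝ) (B : ℝ) : Obs p → ℕ∞ :=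
  MeasureTheory.hittingAfter (statistic c ω) (Set.Ici B) 1

/-- `E_∞(T)`, the average run length to false alarm. -/
def avgRunLength {p : ℕ} (T : Obs p → ℕ∞) : ℝ≥0∞ :=
  ∫⁻ x, (T x : ℝ≥0∞) ∂(lawNoChange p)

/-- The worst-case detection delay
`D_μ(T) = sup_{1 ≤ ν < ∞} ess sup E_{μ,ν}(T - ν + 1 | T ≥ ν, ℱ_{ν-1})`. The essential supremum is
over the event `T ≥ ν`, on which the (truncated) subtraction in `T + 1 - ν` is exact. -/
def detectionDelay {p : ℕ} (μ : Fin p → ℝ) (T : Obs p → ℕ∞) : ℝ≥0∞ :=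
  ⨆ (ν : ℕ) (_ : 1 ≤ ν),
    essSup
      (MeasureTheory.condLExp (info p (ν - 1)) (lawChange μ ν)
        (fun x => (T x : ℝ≥0∞) + 1 - (ν : ℝ≥0∞)))
      ((lawChange μ ν).restrict {x | (ν : ℕ∞) ≤ T x})

/-- `μ*_k = c μ_k + (1 - c) ω_k`, the limit of the estimator when the true mean is `μ_k`. -/
def muStar {p : ℕ} (c : ℝ) (ω μ : Fin p → ℝ) : Fin p → ℝ :=
  fun k => c * μ k + (1 - c) * ω k

/-- The information number `I(θ, φ; μ) = E_μ ∑_k log (f_{θ_k}(X_k) / f_{φ_k}(X_k))`. -/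
def infoNumber {p : ℕ} (θ φ μ : Fin p → ℝ) : ℝ :=
  ∫ y, ∑ k : Fin p, Real.log
    (ProbabilityTheory.gaussianPDFReal (θ k) 1 (y k) /
      ProbabilityTheory.gaussianPDFReal (φ k) 1 (y k)) ∂(obsLaw μ)

end

end SRRS

/-! ### Independence of the past and the next observation; measurability of the statistics -/

open scoped ENNReal
open MeasureTheory ProbabilityTheory

namespace SRRS

/-! False alarms. Given the past, the plug-in estimate is a constant, and a Gaussian likelihood
ratio has mean one under the null law. So each `Λ_{n,m}` is a martingale in `n` starting from the
value 1, and `∑_{m ≤ n} Λ_{n,m} - n` is a martingale too. Stopping it at the alarm or at `N`,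
whichever comes first, gives `B P(N_B ≤ N) ≤ E min(N_B, N)` (`mul_prob_compl_le_sum`). If `E N_B` is
finite, let `N → ∞`.

Delay. The statistic dominates `Λ_{n,ν}`, which only sees observations from `ν` on. These are
independent of the past, and shifted in time they follow the law with a change at 1. Hence the delay
is at most the mean of the first time that `L_n = log Λ_{n,1}` reaches `b = log B`
(`detectionDelay_alarmTime_le`).

Let `Y_j` be the average noise up to time `j` and `ε_{j+1}` the next noise. Then `L_{j+1} - L_j = I
+ ⟨μ*, ε_{j+1}⟩ + c ⟨Y_j, gap⟩ + c ⟨Y_j, ε_{j+1}⟩ - (c²/2) ‖Y_j‖²` (`llrIncr_eq`). As `E ‖Y_j‖² = p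
/ j`, the mean of `L_n` is `I (n - 1) - (p c²/2) ∑_{j<n} 1/j`, and this harmonic sum is the source
of the `log log B` term.

The obstacle is that the linear errors `⟨Y_j, gap⟩` have size `j^{-1/2}` and are correlated with the
passage time, so bounding them in absolute value from time 1 on is too expensive. Therefore Wald's
argument starts at a deterministic time `n₁`, slightly before `n₀ ≈ b / I`, up to which every time
is simply counted. Since `L` fluctuates by little more than `√n₀`
(`integral_max_abs_logLR_sub_sqrt_mul_log_le`), it is below `b` at `n₁`, and above `b` at a time
`n₂` slightly later, up to bounded mean errors; the distance `n₂ - n₁` is about `2 δ √n₀ log n₀`. At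
`n₁` the exact mean of `L` can be used. In the window the linear errors cost `O(δ log n₀)`, and
after `n₂` only a bounded mean time remains, by the crude estimate `meanSurvival_le`. The squared
errors after `n₁` cost `O(1)`, and exponential moments bound the overshoot by an arbitrarily small
multiple of `log n₀`. Collecting terms gives `exists_mul_add_meanSurvival_le`. -/

instance isProbabilityMeasure_obsLaw {p : ℕ} (m : Fin p → ℝ) : IsProbabilityMeasure (obsLaw m) := by
  unfold obsLaw; infer_instance

instance isProbabilityMeasure_lawNoChange (p : ℕ) : IsProbabilityMeasure (lawNoChange p) := by
  unfold lawNoChange; infer_instance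

instance isProbabilityMeasure_lawChange {p : ℕ} (μ : Fin p → ℝ) (ν : ℕ) :
    IsProbabilityMeasure (lawChange μ ν) := by
  unfold lawChange; infer_instance

/-- The law of independent observation vectors whose means are `m n`. -/
noncomputable def seqLaw {p : ℕ} (m : ℕ → Fin p → ℝ) : Measure (Obs p) :=
  Measure.infinitePi fun n => obsLaw (m n)

instance isProbabilityMeasure_seqLaw {p : ℕ} (m : ℕ → Fin p → ℝ) :
    IsProbabilityMeasure (seqLaw m) := by
  unfold seqLaw; infer_instance

theorem lawNoChange_eq_seqLaw (p : ℕ) : lawNoChange p = seqLaw fun _ => 0 := rfl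

theorem lawChange_eq_seqLaw {p : ℕ} (μ : Fin p → ℝ) (ν : ℕ) :
    lawChange μ ν = seqLaw fun n => if ν ≤ n then μ else 0 := rfl

variable {p : ℕ} (m : ℕ → Fin p → ℝ)

theorem indep_info_future (n : ℕ) :
    Indep (info p n)
      (⨆ i ∈ Set.Ioi n, MeasurableSpace.comap (fun x : Obs p => x i) inferInstance)
      (seqLaw m) := by
  have h : iIndepFun (fun i (x : Obs p) => x i) (seqLaw m) :=
    iIndepFun_infinitePi (P := fun n => obsLaw (m n)) (X := fun _ y => y) fun _ => measurable_id
  have h2 := indep_iSup_of_disjoint (fun i => (measurable_pi_apply i).comap_le) h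
    (S := Set.Icc 1 n) (T := Set.Ioi n)
    (Set.disjoint_left.2 fun i hi hj => absurd hi.2 (not_le.2 hj))
  refine indep_of_indep_of_le_left h2 ?_
  refine iSup₂_le fun i hi => ?_
  exact le_iSup₂_of_le i (by simpa using hi) le_rfl

theorem indep_info_next (n : ℕ) :
    Indep (info p n) (MeasurableSpace.comap (fun x : Obs p => x (n + 1)) inferInstance)
      (seqLaw m) :=
  indep_of_indep_of_le_right (indep_info_future m n)
    (le_iSup₂_of_le (n + 1) (Set.mem_Ioi.2 n.lt_succ_self) le_rfl)

theorem map_eval_seqLaw (n : ℕ) : (seqLaw m).map (fun x => x n) = obsLaw (m n) :=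
  Measure.infinitePi_map_eval (fun n => obsLaw (m n)) n

theorem info_le (n : ℕ) : info p n ≤ (inferInstance : MeasurableSpace (Obs p)) :=
  (info p).le n

/-- Conditioning on the past amounts to integrating out the next observation. -/
theorem lintegral_past_next {β : Type*} [MeasurableSpace β] (n : ℕ) {Z : Obs p → β}
    (hZ : Measurable[info p n] Z) {F : β × (Fin p → ℝ) → ℝ≥0∞} (hF : Measurable F) :
    ∫⁻ x, F (Z x, x (n + 1)) ∂(seqLaw m)
      = ∫⁻ x, ∫⁻ y, F (Z x, y) ∂(obsLaw (m (n + 1))) ∂(seqLaw m) := by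
  have hZ' : Measurable Z := hZ.mono (info_le n) le_rfl
  have hX : Measurable fun x : Obs p => x (n + 1) := measurable_pi_apply _
  have hind : IndepFun Z (fun x : Obs p => x (n + 1)) (seqLaw m) := by
    rw [IndepFun_iff_Indep]
    exact indep_of_indep_of_le_left (indep_info_next m n) hZ.comap_le
  have hmap := (indepFun_iff_map_prod_eq_prod_map_map hZ'.aemeasurable hX.aemeasurable).1 hind
  rw [map_eval_seqLaw] at hmap
  calc ∫⁻ x, F (Z x, x (n + 1)) ∂(seqLaw m)
      = ∫⁻ q, F q ∂((seqLaw m).map fun x => (Z x, x (n + 1))) :=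
        (lintegral_map hF (hZ'.prodMk hX)).symm
    _ = _ := by
        rw [hmap, lintegral_prod _ hF.aemeasurable,
          lintegral_map hF.lintegral_prod_right' hZ']

theorem indepFun_past_next (n : ℕ) {G : Obs p → ℝ} (hG : Measurable[info p n] G)
    {H : (Fin p → ℝ) → ℝ} (hH : Measurable H) :
    IndepFun G (fun x => H (x (n + 1))) (seqLaw m) := by
  rw [IndepFun_iff_Indep]
  refine indep_of_indep_of_le_left (indep_of_indep_of_le_right (indep_info_next m n) ?_) hG.comap_le
  exact (hH.comp (comap_measurable fun x : Obs p => x (n + 1))).comap_le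

theorem integral_past_mul_next (n : ℕ) {G : Obs p → ℝ} (hG : Measurable[info p n] G)
    {H : (Fin p → ℝ) → ℝ} (hH : Measurable H) :
    ∫ x, G x * H (x (n + 1)) ∂(seqLaw m)
      = (∫ x, G x ∂(seqLaw m)) * ∫ y, H y ∂(obsLaw (m (n + 1))) := by
  have hX : Measurable fun x : Obs p => x (n + 1) := measurable_pi_apply _
  rw [(indepFun_past_next m n hG hH).integral_fun_mul_eq_mul_integral
    (hG.mono (info_le n) le_rfl).aestronglyMeasurable (hH.comp hX).aestronglyMeasurable,
    ← map_eval_seqLaw, integral_map hX.aemeasurable hH.aestronglyMeasurable]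

theorem measurable_obs_info {i n : ℕ} (h1 : 1 ≤ i) (hn : i ≤ n) :
    Measurable[info p n] fun x : Obs p => x i :=
  Measurable.mono (comap_measurable _)
    (le_iSup₂_of_le (f := fun i (_ : i ∈ Finset.Icc 1 n) =>
      MeasurableSpace.comap (fun x : Obs p => x i) inferInstance) i
      (Finset.mem_Icc.2 ⟨h1, hn⟩) le_rfl) le_rfl

theorem measurable_obs_apply_info {i n : ℕ} (h1 : 1 ≤ i) (hn : i ≤ n) (k : Fin p) :
    Measurable[info p n] fun x : Obs p => x i k :=
  (measurable_pi_apply k).comp (measurable_obs_info h1 hn)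

theorem measurable_estimate_info (c : ℝ) (ω : Fin p → ℝ) (k : Fin p) {j l n : ℕ} (hj : 1 ≤ j)
    (hl : l ≤ n + 1) : Measurable[info p n] fun x : Obs p => estimate c ω x k j l := by
  unfold estimate
  split_ifs
  · exact measurable_const
  · refine measurable_const.add (measurable_const.mul (Measurable.sub_const ?_ _))
    refine Measurable.div_const (Finset.measurable_sum _ fun i hi => ?_) _
    rw [Finset.mem_Ico] at hi
    exact measurable_obs_apply_info (by omega) (by omega) k

theorem measurable_plugInLR_info (c : ℝ) (ω : Fin p → ℝ) {j n N : ℕ} (hj : 1 ≤ j) (hn : n ≤ N) :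
    Measurable[info p N] fun x : Obs p => plugInLR c ω n j x := by
  unfold plugInLR
  refine Finset.measurable_prod _ fun l hl => Finset.measurable_prod _ fun k _ => ?_
  rw [Finset.mem_Icc] at hl
  have h1 : Measurable[info p N] fun x : Obs p => x l k :=
    measurable_obs_apply_info (by omega) (by omega) k
  have h2 : Measurable[info p N] fun x : Obs p => estimate c ω x k j l :=
    measurable_estimate_info c ω k hj (by omega)
  have h3 : Measurable fun q : ℝ × ℝ => gaussianPDFReal q.1 1 q.2 :=
    measurable_uncurry_gaussianPDFReal.comp
      (measurable_fst.prodMk (measurable_const.prodMk measurable_snd))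
  exact (h3.comp (h2.prodMk h1)).div ((measurable_gaussianPDFReal 0 1).comp h1)

theorem measurable_statistic_info (c : ℝ) (ω : Fin p → ℝ) {n N : ℕ} (hn : n ≤ N) :
    Measurable[info p N] fun x : Obs p => statistic c ω n x := by
  unfold statistic
  exact Finset.measurable_sum _ fun j hj =>
    measurable_plugInLR_info c ω (Finset.mem_Icc.1 hj).1 hn

theorem gaussianPDFReal_div_gaussianPDFReal (a x : ℝ) :
    gaussianPDFReal a 1 x / gaussianPDFReal 0 1 x = Real.exp (a * x - a ^ 2 / 2) := by
  have h : (√(2 * Real.pi * ((1 : NNReal) : ℝ)))⁻¹ ≠ 0 := by positivity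
  simp only [gaussianPDFReal_def]
  rw [mul_div_mul_left _ _ h, ← Real.exp_sub]
  congr 1
  simp
  ring

end SRRS

/-! ### False alarms: the martingale property and optional stopping -/

namespace SRRS

theorem toENNReal_eq_tsum (t : ℕ∞) :
    (t : ℝ≥0∞) = ∑' n : ℕ, {m : ℕ | (m : ℕ∞) < t}.indicator 1 n := by
  induction t using ENat.recTopCoe with
  | top => simp
  | coe t =>
    rw [tsum_eq_sum (s := Finset.range t) fun n hn => by
      simpa [Set.indicator] using hn]
    rw [Finset.sum_congr rfl fun n hn => by
      rw [Set.indicator_of_mem (by simpa using hn)]]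
    simp

/-- Counts the times strictly before `T`. Means of hitting times thus become sums of probabilities
of events determined by finitely many observations, with no need to treat the value `∞` apart. -/
theorem toENNReal_hittingAfter {Ω : Type*} (u : ℕ → Ω → ℝ) (B : ℝ) {T : Ω → ℕ∞}
    (hT : T = hittingAfter u (Set.Ici B) 1) (x : Ω) :
    (T x : ℝ≥0∞) = ∑' n : ℕ, {y : Ω | ∀ j ∈ Finset.Icc 1 n, u j y < B}.indicator 1 x := by
  rw [toENNReal_eq_tsum]
  refine tsum_congr fun n => ?_
  have h : ((n : ℕ∞) < T x) ↔ ∀ j ∈ Finset.Icc 1 n, u j x < B := by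
    rw [← not_le, hT]
    have := hittingAfter_le_iff (u := u) (s := Set.Ici B) (n := 1) (i := n) (ω := x)
    refine (not_congr this).trans ?_
    simp
  by_cases hx : (n : ℕ∞) < T x
  · rw [Set.indicator_of_mem (show n ∈ {m : ℕ | (m : ℕ∞) < T x} from hx),
      Set.indicator_of_mem (show x ∈ {y : Ω | ∀ j ∈ Finset.Icc 1 n, u j y < B} from h.1 hx)]
    rfl
  · rw [Set.indicator_of_notMem (show n ∉ {m : ℕ | (m : ℕ∞) < T x} from hx),
      Set.indicator_of_notMem (show x ∉ {y : Ω | ∀ j ∈ Finset.Icc 1 n, u j y < B} from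
        fun h' => hx (h.2 h'))]

variable {p : ℕ}

/-- Each factor is `exp (a t - a² / 2)`, whose mean is 1 by the Gaussian moment generating function.
This is the martingale property for a fixed estimate. -/
theorem lintegral_obsLaw_ratio (a : Fin p → ℝ) :
    ∫⁻ y, ENNReal.ofReal (∏ k, gaussianPDFReal (a k) 1 (y k) / gaussianPDFReal 0 1 (y k))
      ∂(obsLaw 0) = 1 := by
  have hint : ∀ k, Integrable (fun t => gaussianPDFReal (a k) 1 t / gaussianPDFReal 0 1 t)
      (gaussianReal 0 1) := by
    intro k
    simp_rw [gaussianPDFReal_div_gaussianPDFReal, Real.exp_sub]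
    exact (integrable_exp_mul_gaussianReal _).div_const _
  have hone : ∀ k, ∫ t, gaussianPDFReal (a k) 1 t / gaussianPDFReal 0 1 t ∂(gaussianReal 0 1)
      = 1 := by
    intro k
    have h := congrFun (mgf_fun_id_gaussianReal (μ := 0) (v := 1)) (a k)
    unfold mgf at h
    simp_rw [gaussianPDFReal_div_gaussianPDFReal, Real.exp_sub]
    rw [integral_div, h]
    simp
  unfold obsLaw
  rw [← ofReal_integral_eq_lintegral_ofReal]
  · rw [integral_fintype_prod_eq_prod (μ := fun k : Fin p => gaussianReal ((0 : Fin p → ℝ) k) 1)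
      (fun k t => gaussianPDFReal (a k) 1 t / gaussianPDFReal 0 1 t)]
    simp [hone]
  · exact Integrable.fintype_prod (μ := fun k : Fin p => gaussianReal ((0 : Fin p → ℝ) k) 1) hint
  · exact Filter.Eventually.of_forall fun y => Finset.prod_nonneg fun k _ =>
      div_nonneg (gaussianPDFReal_nonneg _ _ _) (gaussianPDFReal_nonneg _ _ _)

variable (c : ℝ) (ω : Fin p → ℝ)

theorem plugInLR_succ {n j : ℕ} (h : j ≤ n + 1) (x : Obs p) :
    plugInLR c ω (n + 1) j x = plugInLR c ω n j x *
      ∏ k, gaussianPDFReal (estimate c ω x k j (n + 1)) 1 (x (n + 1) k) /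
        gaussianPDFReal 0 1 (x (n + 1) k) := by
  unfold plugInLR
  rw [Finset.prod_Icc_succ_top h]

theorem plugInLR_nonneg (n j : ℕ) (x : Obs p) : 0 ≤ plugInLR c ω n j x :=
  Finset.prod_nonneg fun _ _ => Finset.prod_nonneg fun _ _ =>
    div_nonneg (gaussianPDFReal_nonneg _ _ _) (gaussianPDFReal_nonneg _ _ _)

theorem plugInLR_self (n : ℕ) (x : Obs p) : plugInLR c ω n n x = 1 := by
  unfold plugInLR
  simp only [Finset.Icc_self, Finset.prod_singleton]
  refine Finset.prod_eq_one fun k _ => ?_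
  rw [estimate, if_pos le_rfl]
  exact div_self (gaussianPDFReal_pos _ _ _ one_ne_zero).ne'

theorem measurable_mul_ratio (p : ℕ) :
    Measurable fun q : (ℝ≥0∞ × (Fin p → ℝ)) × (Fin p → ℝ) => q.1.1 *
      ENNReal.ofReal (∏ k, gaussianPDFReal (q.1.2 k) 1 (q.2 k) / gaussianPDFReal 0 1 (q.2 k)) := by
  simp_rw [gaussianPDFReal_div_gaussianPDFReal]
  fun_prop

/-- Without a change, one more observation leaves each likelihood ratio unchanged on average. -/
theorem setLIntegral_plugInLR_succ {n j : ℕ} (hj : j ∈ Finset.Icc 1 n) {A : Set (Obs p)}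
    (hA : MeasurableSet[info p n] A) :
    ∫⁻ x in A, ENNReal.ofReal (plugInLR c ω (n + 1) j x) ∂(lawNoChange p)
      = ∫⁻ x in A, ENNReal.ofReal (plugInLR c ω n j x) ∂(lawNoChange p) := by
  rw [Finset.mem_Icc] at hj
  have hA' := info_le n A hA
  rw [← lintegral_indicator hA', ← lintegral_indicator hA']
  set G : Obs p → ℝ≥0∞ := A.indicator fun x => ENNReal.ofReal (plugInLR c ω n j x) with hGd
  set E : Obs p → Fin p → ℝ := fun x k => estimate c ω x k j (n + 1) with hEd
  have hG : Measurable[info p n] G :=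
    Measurable.indicator (m := info p n)
      (measurable_plugInLR_info c ω hj.1 le_rfl).ennreal_ofReal hA
  have hE : Measurable[info p n] E :=
    @measurable_pi_lambda _ _ _ (info p n) _ _ fun k =>
      measurable_estimate_info c ω k hj.1 le_rfl
  have h := lintegral_past_next (fun _ => (0 : Fin p → ℝ)) n
    (Z := fun x => (G x, E x)) (hG.prodMk hE) (measurable_mul_ratio p)
  rw [lawNoChange_eq_seqLaw]
  refine Eq.trans (lintegral_congr fun x => ?_) (h.trans (lintegral_congr fun x => ?_))
  · by_cases hx : x ∈ A
    · rw [hGd, Set.indicator_of_mem hx, Set.indicator_of_mem hx,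
        plugInLR_succ c ω (by omega), ENNReal.ofReal_mul (plugInLR_nonneg c ω _ _ _)]
    · rw [hGd, Set.indicator_of_notMem hx, Set.indicator_of_notMem hx, zero_mul]
  · have hfin : G x ≠ ⊤ := by
      by_cases hx : x ∈ A
      · rw [hGd, Set.indicator_of_mem hx]; exact ENNReal.ofReal_ne_top
      · rw [hGd, Set.indicator_of_notMem hx]; exact ENNReal.zero_ne_top
    rw [lintegral_const_mul' _ _ hfin, lintegral_obsLaw_ratio, mul_one]

/-- The old terms keep their integral, and the new term `m = n + 1` is identically 1 because the
estimate without data is 0. So the statistic minus `n` is a martingale. -/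
theorem setLIntegral_statistic_succ (n : ℕ) {A : Set (Obs p)} (hA : MeasurableSet[info p n] A) :
    ∫⁻ x in A, ENNReal.ofReal (statistic c ω (n + 1) x) ∂(lawNoChange p)
      = ∫⁻ x in A, ENNReal.ofReal (statistic c ω n x) ∂(lawNoChange p) + lawNoChange p A := by
  have hm : ∀ N j, 1 ≤ j → Measurable fun x : Obs p => ENNReal.ofReal (plugInLR c ω N j x) :=
    fun N j hj => ((measurable_plugInLR_info c ω hj (le_refl N)).mono (info_le N)
      le_rfl).ennreal_ofReal
  have hsum : ∀ N M, ∫⁻ x in A, ENNReal.ofReal (∑ j ∈ Finset.Icc 1 M, plugInLR c ω N j x)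
      ∂(lawNoChange p) = ∑ j ∈ Finset.Icc 1 M,
        ∫⁻ x in A, ENNReal.ofReal (plugInLR c ω N j x) ∂(lawNoChange p) := by
    intro N M
    rw [← lintegral_finsetSum' _ fun j hj => (hm N j (Finset.mem_Icc.1 hj).1).aemeasurable]
    exact lintegral_congr fun x =>
      ENNReal.ofReal_sum_of_nonneg fun j _ => plugInLR_nonneg c ω _ _ _
  unfold statistic
  rw [hsum, hsum, Finset.sum_Icc_succ_top (by omega)]
  congr 1
  · exact Finset.sum_congr rfl fun j hj => setLIntegral_plugInLR_succ c ω hj hA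
  · simp [plugInLR_self]

theorem measurableSet_statistic_lt (B : ℝ) (n : ℕ) :
    MeasurableSet[info p n] {x : Obs p | ∀ j ∈ Finset.Icc 1 n, statistic c ω j x < B} := by
  have : {x : Obs p | ∀ j ∈ Finset.Icc 1 n, statistic c ω j x < B}
      = ⋂ j ∈ Finset.Icc 1 n, {x | statistic c ω j x < B} := by
    ext; simp
  rw [this]
  refine Finset.measurableSet_biInter _ fun j hj => ?_
  exact measurableSet_lt (measurable_statistic_info c ω (Finset.mem_Icc.1 hj).2) measurable_const

/-- The optional stopping inequality for `∑_{m ≤ n} Λ_{n,m} - n` and the alarm time. -/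
theorem mul_prob_compl_le_sum {B : ℝ} (N : ℕ) :
    (∫⁻ x in {x : Obs p | ∀ j ∈ Finset.Icc 1 N, statistic c ω j x < B},
        ENNReal.ofReal (statistic c ω N x) ∂(lawNoChange p))
      + ENNReal.ofReal B *
        lawNoChange p {x : Obs p | ∀ j ∈ Finset.Icc 1 N, statistic c ω j x < B}ᶜ
    ≤ ∑ n ∈ Finset.range N,
        lawNoChange p {x : Obs p | ∀ j ∈ Finset.Icc 1 n, statistic c ω j x < B} := by
  induction N with
  | zero => simp [statistic]
  | succ N ih =>
    set A : ℕ → Set (Obs p) := fun n => {x | ∀ j ∈ Finset.Icc 1 n, statistic c ω j x < B} with hAd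
    change (∫⁻ x in A (N + 1), _ ∂_) + _ * lawNoChange p (A (N + 1))ᶜ
      ≤ ∑ n ∈ Finset.range (N + 1), lawNoChange p (A n)
    have hA : ∀ n, MeasurableSet (A n) :=
      fun n => info_le n _ (measurableSet_statistic_lt c ω B n)
    have hsub : A (N + 1) ⊆ A N := fun x hx j hj =>
      hx j (Finset.mem_Icc.2 ⟨(Finset.mem_Icc.1 hj).1, (Finset.mem_Icc.1 hj).2.trans N.le_succ⟩)
    have hcompl : (A (N + 1))ᶜ = (A N)ᶜ ∪ (A N \ A (N + 1)) := by
      ext x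
      have := @hsub x
      simp only [Set.mem_compl_iff, Set.mem_union, Set.mem_sdiff]
      tauto
    have hsplit : ∫⁻ x in A N, ENNReal.ofReal (statistic c ω (N + 1) x) ∂(lawNoChange p)
        = (∫⁻ x in A (N + 1), ENNReal.ofReal (statistic c ω (N + 1) x) ∂(lawNoChange p))
          + ∫⁻ x in A N \ A (N + 1), ENNReal.ofReal (statistic c ω (N + 1) x)
            ∂(lawNoChange p) := by
      conv_lhs => rw [← Set.union_sdiff_cancel hsub]
      exact lintegral_union ((hA N).diff (hA _)) Set.disjoint_sdiff_right
    have hexit : ENNReal.ofReal B * lawNoChange p (A N \ A (N + 1))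
        ≤ ∫⁻ x in A N \ A (N + 1), ENNReal.ofReal (statistic c ω (N + 1) x)
            ∂(lawNoChange p) := by
      rw [← setLIntegral_const]
      refine setLIntegral_mono' ((hA N).diff (hA _)) fun x hx => ENNReal.ofReal_le_ofReal ?_
      -- On the difference of the two events the threshold is crossed for the first time at `N + 1`.
      by_contra hlt
      refine hx.2 fun j hj => ?_
      rcases Nat.lt_or_ge j (N + 1) with h | h
      · exact hx.1 j (Finset.mem_Icc.2 ⟨(Finset.mem_Icc.1 hj).1, by omega⟩)
      · have : j = N + 1 := le_antisymm (Finset.mem_Icc.1 hj).2 h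
        rw [this]
        exact not_le.1 hlt
    have hstep := setLIntegral_statistic_succ c ω N (measurableSet_statistic_lt c ω B N)
    rw [Finset.sum_range_succ]
    calc _ ≤ (∫⁻ x in A (N + 1), ENNReal.ofReal (statistic c ω (N + 1) x) ∂(lawNoChange p))
          + (ENNReal.ofReal B * lawNoChange p (A N)ᶜ
            + ENNReal.ofReal B * lawNoChange p (A N \ A (N + 1))) := by
          rw [hcompl, ← mul_add]
          gcongr
          exact measure_union_le _ _
      _ ≤ (∫⁻ x in A (N + 1), ENNReal.ofReal (statistic c ω (N + 1) x) ∂(lawNoChange p))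
          + (ENNReal.ofReal B * lawNoChange p (A N)ᶜ
            + ∫⁻ x in A N \ A (N + 1), ENNReal.ofReal (statistic c ω (N + 1) x)
              ∂(lawNoChange p)) := by gcongr
      _ = (∫⁻ x in A N, ENNReal.ofReal (statistic c ω N x) ∂(lawNoChange p))
          + lawNoChange p (A N) + ENNReal.ofReal B * lawNoChange p (A N)ᶜ := by
          rw [← hstep, hsplit]
          abel
      _ = (∫⁻ x in A N, ENNReal.ofReal (statistic c ω N x) ∂(lawNoChange p))
          + ENNReal.ofReal B * lawNoChange p (A N)ᶜ + lawNoChange p (A N) := by abel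
      _ ≤ _ := by gcongr

theorem ofReal_le_avgRunLength_alarmTime (B : ℝ) :
    ENNReal.ofReal B ≤ avgRunLength (alarmTime c ω B) := by
  set A : ℕ → Set (Obs p) := fun n => {x | ∀ j ∈ Finset.Icc 1 n, statistic c ω j x < B} with hAd
  have hA : ∀ n, MeasurableSet (A n) :=
    fun n => info_le n _ (measurableSet_statistic_lt c ω B n)
  have hE : avgRunLength (alarmTime c ω B) = ∑' n, lawNoChange p (A n) := by
    unfold avgRunLength
    simp_rw [toENNReal_hittingAfter (statistic c ω) B (T := alarmTime c ω B) rfl]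
    rw [lintegral_tsum fun n => (measurable_one.indicator (hA n)).aemeasurable]
    exact tsum_congr fun n => lintegral_indicator_one (hA n)
  rw [hE]
  -- A finite mean forces the tail probabilities to vanish, which is what the passage to the limit
  -- in the stopped inequality needs.
  by_cases htop : ∑' n, lawNoChange p (A n) = ⊤
  · rw [htop]; exact le_top
  have hzero := ENNReal.tendsto_atTop_zero_of_tsum_ne_top htop
  have hlim : Filter.Tendsto (fun N => ENNReal.ofReal B * (1 - lawNoChange p (A N)))
      Filter.atTop (nhds (ENNReal.ofReal B)) := by
    have h1 : Filter.Tendsto (fun N => 1 - lawNoChange p (A N)) Filter.atTop (nhds 1) := by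
      simpa using ENNReal.Tendsto.sub (tendsto_const_nhds (x := (1 : ℝ≥0∞))) hzero
        (Or.inl ENNReal.one_ne_top)
    simpa using ENNReal.Tendsto.const_mul h1 (Or.inr ENNReal.ofReal_ne_top)
  refine le_of_tendsto' hlim fun N => ?_
  rw [← prob_compl_eq_one_sub (hA N)]
  exact (le_add_self.trans (mul_prob_compl_le_sum c ω N)).trans (ENNReal.sum_le_tsum _)

end SRRS

/-! ### Reduction of the worst-case delay to a passage time after a change at time 1 -/

namespace SRRS

/-- The integral of `g` over an event of `m` factorizes, so the constant has the defining property
of the conditional expectation. -/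
theorem condLExp_ae_eq_lintegral_of_indep {Ω : Type*} {m0 : MeasurableSpace Ω}
    {m m' : MeasurableSpace Ω} (hm : m ≤ m0) (hm' : m' ≤ m0) (P : Measure[m0] Ω)
    [IsProbabilityMeasure P] (h : Indep m m' P) {g : Ω → ℝ≥0∞} (hg : Measurable[m'] g) :
    condLExp m P g =ᵐ[P] fun _ => ∫⁻ x, g x ∂P := by
  refine (ae_eq_condLExp hm P g measurable_const fun s hs => ?_).symm
  have h1 : Measurable[m] (s.indicator (1 : Ω → ℝ≥0∞)) :=
    Measurable.indicator (m := m) (@measurable_const _ _ _ m 1) hs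
  have h2 := lintegral_mul_eq_lintegral_mul_lintegral_of_independent_measurableSpace hm hm' h h1 hg
  rw [lintegral_indicator_one (hm s hs)] at h2
  rw [setLIntegral_const, mul_comm, ← h2, ← lintegral_indicator (hm s hs)]
  refine lintegral_congr fun x => ?_
  by_cases hx : x ∈ s
  · simp [hx]
  · simp [hx]

variable {p : ℕ} (c : ℝ) (ω : Fin p → ℝ)

/-- Forget the first `d` observation times. -/
def shift (p d : ℕ) (x : Obs p) : Obs p := fun n => x (n + d)

/-- It matters that `info` ignores coordinate 0: after the shift that coordinate holds the
observation of time `d`, which belongs to the past. -/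
theorem measurable_shift_future (d n : ℕ) :
    Measurable[⨆ i ∈ Set.Ioi d, MeasurableSpace.comap (fun x : Obs p => x i) inferInstance,
      info p n] (shift p d) := by
  rw [measurable_iff_comap_le]
  have : info p n = ⨆ i ∈ Finset.Icc 1 n,
    MeasurableSpace.comap (fun x : Obs p => x i) inferInstance := rfl
  rw [this]
  simp only [MeasurableSpace.comap_iSup, MeasurableSpace.comap_comp]
  refine iSup₂_le fun i hi => ?_
  refine le_iSup₂_of_le (i + d) ?_ le_rfl
  have := (Finset.mem_Icc.1 hi).1
  simp only [Set.mem_Ioi]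
  omega

theorem estimate_shift (d : ℕ) (x : Obs p) (k : Fin p) (j l : ℕ) :
    estimate c ω (shift p d x) k j l = estimate c ω x k (j + d) (l + d) := by
  unfold estimate shift
  have h1 : (l ≤ j) = (l + d ≤ j + d) := by simp
  have h2 : ((l + d : ℕ) : ℝ) - ((j + d : ℕ) : ℝ) = l - j := by push_cast; ring
  rw [← Finset.sum_Ico_add' (fun i => x i k) j l d, h2]
  simp only [h1]

theorem plugInLR_shift (d n j : ℕ) (x : Obs p) :
    plugInLR c ω n j (shift p d x) = plugInLR c ω (n + d) (j + d) x := by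
  unfold plugInLR
  simp only [estimate_shift]
  rw [← Finset.map_add_right_Icc, Finset.prod_map]
  rfl

theorem map_shift_lawChange (μ : Fin p → ℝ) (d : ℕ) :
    (lawChange μ (d + 1)).map (shift p d) = lawChange μ 1 := by
  unfold lawChange
  have h := Measure.map_infinitePi_infinitePi_of_inj
    (P := fun n : ℕ => obsLaw (if d + 1 ≤ n then μ else 0)) (f := fun n : ℕ => n + d)
    (add_left_injective d)
  refine Eq.trans h ?_
  congr 1
  funext n
  have : (d + 1 ≤ n + d) = (1 ≤ n) := by simp [add_comm]
  simp only [this]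

theorem measurableSet_plugInLR_lt (B : ℝ) (n : ℕ) :
    MeasurableSet[info p n] {x : Obs p | ∀ j ∈ Finset.Icc 1 n, plugInLR c ω j 1 x < B} := by
  have : {x : Obs p | ∀ j ∈ Finset.Icc 1 n, plugInLR c ω j 1 x < B}
      = ⋂ j ∈ Finset.Icc 1 n, {x | plugInLR c ω j 1 x < B} := by
    ext; simp
  rw [this]
  refine Finset.measurableSet_biInter _ fun j hj => ?_
  exact measurableSet_lt (measurable_plugInLR_info c ω le_rfl (Finset.mem_Icc.1 hj).2)
    measurable_const

/-- The first time the likelihood ratio for a change at time `1` reaches `B`. -/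
noncomputable def passageTime {p : ℕ} (c : ℝ) (ω : Fin p → ℝ) (B : ℝ) : Obs p → ℕ∞ :=
  hittingAfter (fun n x => plugInLR c ω n 1 x) (Set.Ici B) 1

/-- The statistic is a sum of nonnegative terms, one of which is the likelihood ratio started at `d
+ 1`. After the shift this is the ratio started at 1. -/
theorem alarmTime_le_add_passageTime (B : ℝ) (d : ℕ) (x : Obs p) :
    alarmTime c ω B x ≤ passageTime c ω B (shift p d x) + d := by
  rcases eq_or_ne (passageTime c ω B (shift p d x)) ⊤ with h | h
  · rw [h]; simp
  lift passageTime c ω B (shift p d x) to ℕ using h with t ht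
  obtain ⟨j, hj, hB⟩ := (hittingAfter_le_iff (u := fun n x => plugInLR c ω n 1 x)
    (s := Set.Ici B) (n := 1) (i := t) (ω := shift p d x)).1 ht.ge
  rw [Set.mem_Ici, plugInLR_shift] at hB
  have h2 : B ≤ statistic c ω (j + d) x := by
    refine hB.trans ?_
    unfold statistic
    refine Finset.single_le_sum (f := fun m => plugInLR c ω (j + d) m x)
      (fun m _ => plugInLR_nonneg c ω _ _ _) ?_
    have := hj.1
    rw [Finset.mem_Icc]; omega
  have h3 : alarmTime c ω B x ≤ ((j + d : ℕ) : ℕ∞) :=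
    hittingAfter_le_of_mem (by have := hj.1; omega) h2
  refine h3.trans ?_
  exact_mod_cast Nat.add_le_add_right hj.2 d

theorem measurable_passageTime_comp_shift (B : ℝ) (d : ℕ) :
    Measurable[⨆ i ∈ Set.Ioi d, MeasurableSpace.comap (fun x : Obs p => x i) inferInstance]
      fun x : Obs p => (passageTime c ω B (shift p d x) : ℝ≥0∞) := by
  simp_rw [toENNReal_hittingAfter (fun n x => plugInLR c ω n 1 x) B (T := passageTime c ω B) rfl]
  refine Measurable.ennreal_tsum fun n => ?_
  have h1 : Measurable[info p n] ({x : Obs p | ∀ j ∈ Finset.Icc 1 n,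
      plugInLR c ω j 1 x < B}.indicator (1 : Obs p → ℝ≥0∞)) :=
    Measurable.indicator (m := info p n) (@measurable_const _ _ _ (info p n) 1)
      (measurableSet_plugInLR_lt c ω B n)
  exact h1.comp (measurable_shift_future d n)

/-- For `ν = d + 1` the delay is dominated by a passage time of the observations after `d`.
Independence makes its conditional mean a constant, and shifting time makes that constant the same
for all `ν`. -/
theorem detectionDelay_alarmTime_le (μ : Fin p → ℝ) (B : ℝ) :
    detectionDelay μ (alarmTime c ω B) ≤
      ∑' n, lawChange μ 1 {x : Obs p | ∀ j ∈ Finset.Icc 1 n, plugInLR c ω j 1 x < B} := by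
  unfold detectionDelay
  refine iSup₂_le fun ν hν => ?_
  obtain ⟨d, rfl⟩ : ∃ d, ν = d + 1 := ⟨ν - 1, by omega⟩
  have hfut : (⨆ i ∈ Set.Ioi d, MeasurableSpace.comap (fun x : Obs p => x i) inferInstance)
      ≤ (inferInstance : MeasurableSpace (Obs p)) :=
    iSup₂_le fun i _ => (measurable_pi_apply i).comap_le
  have hind := indep_info_future (fun n => if d + 1 ≤ n then μ else 0) d
  rw [← lawChange_eq_seqLaw] at hind
  have hmeas := measurable_passageTime_comp_shift c ω B d
  have hle : ∀ x : Obs p, (alarmTime c ω B x : ℝ≥0∞) + 1 - ((d + 1 : ℕ) : ℝ≥0∞)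
      ≤ (passageTime c ω B (shift p d x) : ℝ≥0∞) := by
    intro x
    have h1 : (alarmTime c ω B x : ℝ≥0∞) ≤ (passageTime c ω B (shift p d x) : ℝ≥0∞) + d := by
      have := ENat.toENNReal_mono (alarmTime_le_add_passageTime c ω B d x)
      simpa using this
    rw [tsub_le_iff_right]
    push_cast
    rw [← add_assoc]
    gcongr
  have hsh : Measurable (shift p d) := measurable_pi_lambda _ fun n => measurable_pi_apply _
  have hset : ∀ n, MeasurableSet
      {x : Obs p | ∀ j ∈ Finset.Icc 1 n, plugInLR c ω j 1 x < B} :=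
    fun n => info_le n _ (measurableSet_plugInLR_lt c ω B n)
  have hval : ∫⁻ x, (passageTime c ω B (shift p d x) : ℝ≥0∞) ∂(lawChange μ (d + 1))
      = ∑' n, lawChange μ 1 {x : Obs p | ∀ j ∈ Finset.Icc 1 n, plugInLR c ω j 1 x < B} := by
    simp_rw [toENNReal_hittingAfter (fun n x => plugInLR c ω n 1 x) B
      (T := passageTime c ω B) rfl]
    have hm : Measurable fun y : Obs p => ∑' n : ℕ,
        {y : Obs p | ∀ j ∈ Finset.Icc 1 n, plugInLR c ω j 1 y < B}.indicator
          (1 : Obs p → ℝ≥0∞) y :=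
      Measurable.tsum fun n => measurable_one.indicator (hset n)
    rw [← lintegral_map hm hsh, map_shift_lawChange,
      lintegral_tsum fun n => (measurable_one.indicator (hset n)).aemeasurable]
    exact tsum_congr fun n => lintegral_indicator_one (hset n)
  have hcond := condLExp_ae_eq_lintegral_of_indep (info_le d) hfut _ hind hmeas
  have hmono := condLExp_mono (mΩ := info p d) (P := lawChange μ (d + 1))
    (Filter.Eventually.of_forall hle)
  refine essSup_le_of_ae_le _ (ae_restrict_of_ae ?_)
  simp only [Nat.add_sub_cancel]
  filter_upwards [hcond, hmono] with x h1 h2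
  exact h2.trans (h1.le.trans hval.le)

end SRRS

/-! ### Moments of the noise and of its running averages -/

namespace SRRS

/-- A random variable all of whose absolute moments are finite. -/
structure HasMoments {Ω : Type*} [MeasurableSpace Ω] (P : Measure Ω) (f : Ω → ℝ) : Prop where
  measurable : Measurable f
  integrable_pow : ∀ n : ℕ, Integrable (fun x => |f x| ^ n) P

namespace HasMoments

variable {Ω : Type*} [MeasurableSpace Ω] {P : Measure Ω} {f g : Ω → ℝ}

theorem of_bound (hg : HasMoments P g) (hf : Measurable f) (h : ∀ x, |f x| ≤ |g x|) :
    HasMoments P f := by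
  refine ⟨hf, fun n => (hg.integrable_pow n).mono' ?_ (Filter.Eventually.of_forall fun x => ?_)⟩
  · exact ((hf.abs).pow_const n).aestronglyMeasurable
  · rw [Real.norm_eq_abs, abs_pow, abs_abs]
    exact pow_le_pow_left₀ (abs_nonneg _) (h x) n

theorem integrable (hf : HasMoments P f) : Integrable f P := by
  have h := hf.integrable_pow 1
  simp only [pow_one] at h
  exact (integrable_norm_iff hf.measurable.aestronglyMeasurable).1 h

theorem const [IsFiniteMeasure P] (a : ℝ) : HasMoments P fun _ => a :=
  ⟨measurable_const, fun _ => integrable_const _⟩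

theorem mul (hf : HasMoments P f) (hg : HasMoments P g) : HasMoments P fun x => f x * g x := by
  refine ⟨hf.measurable.mul hg.measurable, fun n => ?_⟩
  refine ((hf.integrable_pow (2 * n)).add (hg.integrable_pow (2 * n))).mono'
    (((hf.measurable.mul hg.measurable).abs.pow_const n).aestronglyMeasurable)
    (Filter.Eventually.of_forall fun x => ?_)
  rw [Real.norm_eq_abs, abs_pow, abs_abs, abs_mul, mul_pow]
  simp only [Pi.add_apply]
  rw [pow_mul', pow_mul']
  nlinarith [sq_nonneg (|f x| ^ n - |g x| ^ n), sq_nonneg (|f x| ^ n), sq_nonneg (|g x| ^ n)]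

theorem add (hf : HasMoments P f) (hg : HasMoments P g) : HasMoments P fun x => f x + g x := by
  refine ⟨hf.measurable.add hg.measurable, fun n => ?_⟩
  refine (((hf.integrable_pow n).add (hg.integrable_pow n)).const_mul (2 ^ n)).mono'
    (((hf.measurable.add hg.measurable).abs.pow_const n).aestronglyMeasurable)
    (Filter.Eventually.of_forall fun x => ?_)
  rw [Real.norm_eq_abs, abs_pow, abs_abs]
  simp only [Pi.add_apply]
  have h1 : |f x + g x| ≤ 2 * max |f x| |g x| := by
    have := abs_add_le (f x) (g x)
    have := le_max_left |f x| |g x|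
    have := le_max_right |f x| |g x|
    linarith
  have h2 : (max |f x| |g x|) ^ n ≤ |f x| ^ n + |g x| ^ n := by
    rcases max_choice |f x| |g x| with h | h <;> rw [h]
    · linarith [pow_nonneg (abs_nonneg (g x)) n]
    · linarith [pow_nonneg (abs_nonneg (f x)) n]
  calc _ ≤ (2 * max |f x| |g x|) ^ n := pow_le_pow_left₀ (abs_nonneg _) h1 n
    _ = 2 ^ n * (max |f x| |g x|) ^ n := mul_pow _ _ _
    _ ≤ _ := mul_le_mul_of_nonneg_left h2 (by positivity)

theorem neg (hf : HasMoments P f) : HasMoments P fun x => -f x :=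
  hf.of_bound hf.measurable.neg fun x => by rw [abs_neg]

theorem sub (hf : HasMoments P f) (hg : HasMoments P g) : HasMoments P fun x => f x - g x := by
  simpa only [sub_eq_add_neg] using hf.add hg.neg

theorem abs (hf : HasMoments P f) : HasMoments P fun x => |f x| :=
  hf.of_bound hf.measurable.abs fun x => by rw [abs_abs]

theorem const_mul (hf : HasMoments P f) (a : ℝ) : HasMoments P fun x => a * f x := by
  refine ⟨hf.measurable.const_mul a, fun n => ?_⟩
  simp only [abs_mul, mul_pow]
  exact (hf.integrable_pow n).const_mul _

theorem mul_const (hf : HasMoments P f) (a : ℝ) : HasMoments P fun x => f x * a := by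
  simpa only [mul_comm] using hf.const_mul a

theorem div_const (hf : HasMoments P f) (a : ℝ) : HasMoments P fun x => f x / a := by
  simpa only [div_eq_mul_inv] using hf.mul_const a⁻¹

theorem sum [IsFiniteMeasure P] {ι : Type*} (s : Finset ι) {F : ι → Ω → ℝ}
    (h : ∀ i ∈ s, HasMoments P (F i)) : HasMoments P fun x => ∑ i ∈ s, F i x := by
  classical
  induction s using Finset.induction_on with
  | empty => simpa using const (P := P) 0
  | insert i s hi ih =>
    simp only [Finset.sum_insert hi]
    exact (h i (Finset.mem_insert_self _ _)).add
      (ih fun j hj => h j (Finset.mem_insert_of_mem hj))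

theorem pow [IsFiniteMeasure P] (hf : HasMoments P f) (n : ℕ) : HasMoments P fun x => f x ^ n := by
  induction n with
  | zero => simpa using const (P := P) 1
  | succ n ih => simpa only [pow_succ] using ih.mul hf

theorem max_zero (hf : HasMoments P f) : HasMoments P fun x => max (f x) 0 := by
  refine hf.of_bound (hf.measurable.max measurable_const) fun x => ?_
  rw [abs_of_nonneg (le_max_right _ _)]
  exact max_le (le_abs_self _) (abs_nonneg _)

theorem indicator_mul (hf : HasMoments P f) {A : Set Ω} (hA : MeasurableSet A) :
    HasMoments P fun x => A.indicator 1 x * f x := by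
  refine hf.of_bound ((measurable_one.indicator hA).mul hf.measurable) fun x => ?_
  by_cases hx : x ∈ A <;> simp [hx]

end HasMoments

theorem hasMoments_gaussian (a : ℝ) :
    HasMoments (gaussianReal a 1) fun x => x := by
  refine ⟨measurable_id, fun n => ?_⟩
  have h := (memLp_id_gaussianReal (μ := a) (v := 1) n).integrable_norm_pow'
  simpa using h

variable {p : ℕ} (c : ℝ) (ω μ : Fin p → ℝ)

theorem map_eval_obsLaw (k : Fin p) : (obsLaw μ).map (fun y => y k) = gaussianReal (μ k) 1 :=
  (measurePreserving_eval (fun k => gaussianReal (μ k) 1) k).map_eq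

theorem HasMoments.comp_of_map {Ω Ω' : Type*} [MeasurableSpace Ω] [MeasurableSpace Ω']
    {P : Measure Ω} {Q : Measure Ω'} {X : Ω → Ω'} (hX : Measurable X) (hmap : P.map X = Q)
    {f : Ω' → ℝ} (hf : HasMoments Q f) : HasMoments P fun x => f (X x) := by
  refine ⟨hf.measurable.comp hX, fun n => ?_⟩
  have := hf.integrable_pow n
  rw [← hmap] at this
  exact (integrable_map_measure (hf.measurable.abs.pow_const n).aestronglyMeasurable
    hX.aemeasurable).1 this

theorem hasMoments_obsLaw (k : Fin p) : HasMoments (obsLaw μ) fun y => y k - μ k :=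
  (HasMoments.comp_of_map (measurable_pi_apply k) (map_eval_obsLaw μ k)
    (hasMoments_gaussian _)).sub (HasMoments.const _)

theorem map_eval_lawChange {n : ℕ} (hn : 1 ≤ n) :
    (lawChange μ 1).map (fun x => x n) = obsLaw μ := by
  rw [lawChange_eq_seqLaw, map_eval_seqLaw, if_pos hn]

/-- The noise of stream `k` at time `i`, when the change has happened at time `1`. -/
def noise (i : ℕ) (k : Fin p) (x : Obs p) : ℝ := x i k - μ k

/-- The noise at time `i` in direction `v`. -/
def noiseDir (v : Fin p → ℝ) (i : ℕ) (x : Obs p) : ℝ := ∑ k, v k * noise μ i k x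

/-- The average noise up to time `n`. -/
noncomputable def avgNoise (n : ℕ) (k : Fin p) (x : Obs p) : ℝ :=
  (∑ i ∈ Finset.Icc 1 n, noise μ i k x) / n

/-- The squared length of the average noise. -/
noncomputable def avgSq (n : ℕ) (x : Obs p) : ℝ := ∑ k, avgNoise μ n k x ^ 2

theorem hasMoments_noise {i : ℕ} (hi : 1 ≤ i) (k : Fin p) :
    HasMoments (lawChange μ 1) (noise μ i k) :=
  HasMoments.comp_of_map (measurable_pi_apply i) (map_eval_lawChange μ hi) (hasMoments_obsLaw μ k)

theorem hasMoments_noiseDir (v : Fin p → ℝ) {i : ℕ} (hi : 1 ≤ i) :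
    HasMoments (lawChange μ 1) (noiseDir μ v i) :=
  HasMoments.sum _ fun k _ => (hasMoments_noise μ hi k).const_mul _

theorem hasMoments_sum_noise (n : ℕ) (k : Fin p) :
    HasMoments (lawChange μ 1) fun x => ∑ i ∈ Finset.Icc 1 n, noise μ i k x :=
  HasMoments.sum _ fun _ hi => hasMoments_noise μ (Finset.mem_Icc.1 hi).1 k

theorem hasMoments_avgNoise (n : ℕ) (k : Fin p) : HasMoments (lawChange μ 1) (avgNoise μ n k) :=
  (hasMoments_sum_noise μ n k).div_const _

theorem hasMoments_avgSq (n : ℕ) : HasMoments (lawChange μ 1) (avgSq μ n) :=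
  HasMoments.sum _ fun k _ => (hasMoments_avgNoise μ n k).pow 2

theorem measurable_noise_info {i n : ℕ} (h1 : 1 ≤ i) (hn : i ≤ n) (k : Fin p) :
    Measurable[info p n] (noise μ i k) :=
  (measurable_obs_apply_info h1 hn k).sub_const _

theorem measurable_sum_noise_info {j n : ℕ} (hj : j ≤ n) (k : Fin p) :
    Measurable[info p n] fun x => ∑ i ∈ Finset.Icc 1 j, noise μ i k x :=
  Finset.measurable_sum _ fun _ hi =>
    measurable_noise_info μ (Finset.mem_Icc.1 hi).1 ((Finset.mem_Icc.1 hi).2.trans hj) k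

theorem measurable_avgNoise_info {j n : ℕ} (hj : j ≤ n) (k : Fin p) :
    Measurable[info p n] (avgNoise μ j k) :=
  (measurable_sum_noise_info μ hj k).div_const _

theorem measurable_avgSq_info {j n : ℕ} (hj : j ≤ n) : Measurable[info p n] (avgSq μ j) :=
  Finset.measurable_sum _ fun k _ => (measurable_avgNoise_info μ hj k).pow_const _

theorem avgSq_nonneg (n : ℕ) (x : Obs p) : 0 ≤ avgSq μ n x :=
  Finset.sum_nonneg fun _ _ => sq_nonneg _

theorem integral_past_mul_noise (n : ℕ) {G : Obs p → ℝ} (hG : Measurable[info p n] G)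
    {H : (Fin p → ℝ) → ℝ} (hH : Measurable H) :
    ∫ x, G x * H (x (n + 1)) ∂(lawChange μ 1)
      = (∫ x, G x ∂(lawChange μ 1)) * ∫ y, H y ∂(obsLaw μ) := by
  have h := integral_past_mul_next (fun n => if 1 ≤ n then μ else 0) n hG hH
  rw [← lawChange_eq_seqLaw] at h
  simpa using h

theorem integral_obsLaw_sub (k : Fin p) : ∫ y, (y k - μ k) ∂(obsLaw μ) = 0 := by
  have h1 : ∫ y, y k ∂(obsLaw μ) = ∫ t, t ∂(gaussianReal (μ k) 1) := by
    rw [← map_eval_obsLaw μ k, integral_map (φ := fun y : Fin p → ℝ => y k)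
      (measurable_pi_apply k).aemeasurable measurable_id'.aestronglyMeasurable]
  have h2 : Integrable (fun y : Fin p → ℝ => y k) (obsLaw μ) := by
    simpa using ((hasMoments_obsLaw μ k).add (HasMoments.const (μ k))).integrable
  rw [integral_sub h2 (integrable_const _), h1, integral_id_gaussianReal]
  simp

theorem integral_obsLaw_sub_sq (k : Fin p) : ∫ y, (y k - μ k) ^ 2 ∂(obsLaw μ) = 1 := by
  have h1 : ∫ y, (y k - μ k) ^ 2 ∂(obsLaw μ) = ∫ t, (t - μ k) ^ 2 ∂(gaussianReal (μ k) 1) := by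
    rw [← map_eval_obsLaw μ k, integral_map (measurable_pi_apply k).aemeasurable
      (by fun_prop)]
  have h2 := variance_fun_id_gaussianReal (μ := μ k) (v := 1)
  rw [variance_eq_integral measurable_id'.aemeasurable, integral_id_gaussianReal] at h2
  rw [h1, h2]; rfl

theorem integral_past_mul_noise_eq_zero (n : ℕ) {G : Obs p → ℝ} (hG : Measurable[info p n] G)
    (k : Fin p) : ∫ x, G x * noise μ (n + 1) k x ∂(lawChange μ 1) = 0 := by
  have h := integral_past_mul_noise μ n hG (H := fun y => y k - μ k) (by fun_prop)
  rw [integral_obsLaw_sub, mul_zero] at h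
  exact h

theorem integral_past_mul_noise_sq (n : ℕ) {G : Obs p → ℝ} (hG : Measurable[info p n] G)
    (k : Fin p) :
    ∫ x, G x * noise μ (n + 1) k x ^ 2 ∂(lawChange μ 1) = ∫ x, G x ∂(lawChange μ 1) := by
  have h := integral_past_mul_noise μ n hG (H := fun y => (y k - μ k) ^ 2) (by fun_prop)
  rw [integral_obsLaw_sub_sq, mul_one] at h
  exact h

theorem integral_sum_noise (n : ℕ) (k : Fin p) :
    ∫ x, ∑ i ∈ Finset.Icc 1 n, noise μ i k x ∂(lawChange μ 1) = 0 := by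
  rw [integral_finsetSum _ fun i hi => (hasMoments_noise μ (Finset.mem_Icc.1 hi).1 k).integrable]
  refine Finset.sum_eq_zero fun i hi => ?_
  obtain ⟨j, rfl⟩ : ∃ j, i = j + 1 := ⟨i - 1, by have := (Finset.mem_Icc.1 hi).1; omega⟩
  simpa using integral_past_mul_noise_eq_zero μ j (G := fun _ => 1) measurable_const k

theorem integral_sum_noise_sq (n : ℕ) (k : Fin p) :
    ∫ x, (∑ i ∈ Finset.Icc 1 n, noise μ i k x) ^ 2 ∂(lawChange μ 1) = n := by
  induction n with
  | zero => simp
  | succ n ih =>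
    have hS := hasMoments_sum_noise μ n k
    have hm := measurable_sum_noise_info μ (le_refl n) k
    have hε := hasMoments_noise μ (Nat.le_add_left 1 n) k
    simp_rw [Finset.sum_Icc_succ_top (Nat.le_add_left 1 n)]
    set S : Obs p → ℝ := fun x => ∑ i ∈ Finset.Icc 1 n, noise μ i k x with hSd
    have e : ∀ x, (S x + noise μ (n + 1) k x) ^ 2
        = S x ^ 2 + 2 * (S x * noise μ (n + 1) k x) + 1 * noise μ (n + 1) k x ^ 2 := by
      intro x; ring
    change ∫ x, (S x + noise μ (n + 1) k x) ^ 2 ∂_ = _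
    simp_rw [e]
    rw [integral_add ((hS.pow 2).add ((hS.mul hε).const_mul 2)).integrable
        ((hε.pow 2).const_mul 1).integrable,
      integral_add (hS.pow 2).integrable ((hS.mul hε).const_mul 2).integrable,
      integral_const_mul, integral_past_mul_noise_eq_zero μ n hm,
      integral_past_mul_noise_sq μ n (G := fun _ => 1) measurable_const, ih]
    simp

/-- The fourth moment of the sum of the noise is at most quadratic in time. -/
theorem integral_sum_noise_pow_four_le (k : Fin p) : ∃ C : ℝ, 0 ≤ C ∧ ∀ n : ℕ,
    ∫ x, (∑ i ∈ Finset.Icc 1 n, noise μ i k x) ^ 4 ∂(lawChange μ 1) ≤ C * (n : ℝ) ^ 2 := by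
  set M : ℝ := ∫ y, (y k - μ k) ^ 4 ∂(obsLaw μ) with hM
  have hM0 : 0 ≤ M := integral_nonneg fun y => by positivity
  -- One more summand raises the fourth moment by `6 n + M`, the odd cross terms having mean zero;
  -- `(6 + M) n²` grows by `(6 + M) (2 n + 1)`.
  refine ⟨6 + M, by linarith, fun n => ?_⟩
  induction n with
  | zero => simp
  | succ n ih =>
    have hS := hasMoments_sum_noise μ n k
    have hm := measurable_sum_noise_info μ (le_refl n) k
    have hε := hasMoments_noise μ (Nat.le_add_left 1 n) k
    simp_rw [Finset.sum_Icc_succ_top (Nat.le_add_left 1 n)]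
    set S : Obs p → ℝ := fun x => ∑ i ∈ Finset.Icc 1 n, noise μ i k x with hSd
    have e : ∀ x, (S x + noise μ (n + 1) k x) ^ 4
        = S x ^ 4 + 4 * (S x ^ 3 * noise μ (n + 1) k x) + 6 * (S x ^ 2 * noise μ (n + 1) k x ^ 2)
          + 4 * (S x * noise μ (n + 1) k x ^ 3) + 1 * noise μ (n + 1) k x ^ 4 := by
      intro x; ring
    have h3 : ∫ x, S x * noise μ (n + 1) k x ^ 3 ∂(lawChange μ 1) = 0 := by
      have h := integral_past_mul_noise μ n hm (H := fun y => (y k - μ k) ^ 3) (by fun_prop)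
      rw [integral_sum_noise, zero_mul] at h
      exact h
    have h4 : ∫ x, 1 * noise μ (n + 1) k x ^ 4 ∂(lawChange μ 1) = M := by
      have h := integral_past_mul_noise μ n (G := fun _ => 1) measurable_const
        (H := fun y => (y k - μ k) ^ 4) (by fun_prop)
      simpa [noise] using h
    change ∫ x, (S x + noise μ (n + 1) k x) ^ 4 ∂_ ≤ _
    simp_rw [e]
    have i1 := hS.pow 4
    have i2 := ((hS.pow 3).mul hε).const_mul 4
    have i3 := ((hS.pow 2).mul (hε.pow 2)).const_mul 6
    have i4 := (hS.mul (hε.pow 3)).const_mul 4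
    have i5 := (hε.pow 4).const_mul 1
    rw [integral_add (((i1.add i2).add i3).add i4).integrable i5.integrable,
      integral_add ((i1.add i2).add i3).integrable i4.integrable,
      integral_add (i1.add i2).integrable i3.integrable,
      integral_add i1.integrable i2.integrable, integral_const_mul, integral_const_mul,
      integral_const_mul, h4, h3, integral_past_mul_noise_eq_zero μ n (hm.pow_const 3),
      integral_past_mul_noise_sq μ n (hm.pow_const 2), integral_sum_noise_sq]
    push_cast
    have hn : (0 : ℝ) ≤ n := n.cast_nonneg
    nlinarith [mul_nonneg hM0 hn]

/-- Summed over time this gives the logarithm that becomes the second-order term of the delay. -/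
theorem integral_avgSq {n : ℕ} (hn : 1 ≤ n) : ∫ x, avgSq μ n x ∂(lawChange μ 1) = p / n := by
  have hn' : (n : ℝ) ≠ 0 := by positivity
  unfold avgSq
  rw [integral_finsetSum _ fun k _ => ((hasMoments_avgNoise μ n k).pow 2).integrable]
  have h : ∀ k : Fin p, ∫ x, avgNoise μ n k x ^ 2 ∂(lawChange μ 1) = 1 / n := by
    intro k
    simp_rw [avgNoise, div_pow]
    rw [integral_div, integral_sum_noise_sq]
    field_simp
  simp [h, div_eq_mul_inv]

/-- The point is the summable rate `1 / n²`: unlike the first moments, the second moments have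
finite total mass. -/
theorem integral_avgSq_sq_le : ∃ C : ℝ, 0 ≤ C ∧ ∀ n : ℕ, 1 ≤ n →
    ∫ x, avgSq μ n x ^ 2 ∂(lawChange μ 1) ≤ C / (n : ℝ) ^ 2 := by
  choose C hC0 hC using integral_sum_noise_pow_four_le μ
  refine ⟨p * ∑ k, C k, by positivity [Finset.sum_nonneg fun k (_ : k ∈ Finset.univ) => hC0 k],
    fun n hn => ?_⟩
  have hn' : (0 : ℝ) < n := by positivity
  have hle : ∀ x, avgSq μ n x ^ 2 ≤ ∑ k, (p : ℝ) * avgNoise μ n k x ^ 4 := by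
    intro x
    have := sq_sum_le_card_mul_sum_sq (s := Finset.univ) (f := fun k => avgNoise μ n k x ^ 2)
    rw [← Finset.mul_sum]
    simpa [avgSq, ← pow_mul] using this
  have hm : ∀ k, HasMoments (lawChange μ 1) fun x => (p : ℝ) * avgNoise μ n k x ^ 4 :=
    fun k => ((hasMoments_avgNoise μ n k).pow 4).const_mul _
  refine (integral_mono ((hasMoments_avgSq μ n).pow 2).integrable
    (HasMoments.sum Finset.univ fun k _ => hm k).integrable hle).trans ?_
  rw [integral_finsetSum _ fun k _ => (hm k).integrable, Finset.mul_sum, Finset.sum_div]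
  refine Finset.sum_le_sum fun k _ => ?_
  rw [integral_const_mul, mul_div_assoc]
  refine mul_le_mul_of_nonneg_left ?_ p.cast_nonneg
  simp_rw [avgNoise, div_pow]
  rw [integral_div, div_le_div_iff₀ (by positivity) (by positivity)]
  have := hC k n
  nlinarith [pow_pos hn' 2]

end SRRS

/-! ### Increments of the log likelihood ratio and a Wald inequality with overshoot -/

namespace SRRS

variable {p : ℕ} (c : ℝ) (ω μ : Fin p → ℝ)

theorem integral_obsLaw_exp (v : Fin p → ℝ) :
    ∫ y, Real.exp (∑ k, v k * (y k - μ k)) ∂(obsLaw μ) = Real.exp ((∑ k, v k ^ 2) / 2) := by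
  have h1 : ∀ k, ∫ t, Real.exp (v k * (t - μ k)) ∂(gaussianReal (μ k) 1)
      = Real.exp (v k ^ 2 / 2) := by
    intro k
    have h := congrFun (mgf_fun_id_gaussianReal (μ := μ k) (v := 1)) (v k)
    unfold mgf at h
    simp_rw [mul_sub, Real.exp_sub]
    rw [integral_div, h, ← Real.exp_sub]
    congr 1
    simp
    ring
  simp_rw [Real.exp_sum]
  unfold obsLaw
  rw [integral_fintype_prod_eq_prod (μ := fun k : Fin p => gaussianReal (μ k) 1)
    (fun k t => Real.exp (v k * (t - μ k)))]
  simp_rw [h1]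
  rw [← Real.exp_sum, Finset.sum_div]

theorem integrable_obsLaw_exp (v : Fin p → ℝ) :
    Integrable (fun y => Real.exp (∑ k, v k * (y k - μ k))) (obsLaw μ) := by
  refine Integrable.of_integral_ne_zero ?_
  rw [integral_obsLaw_exp]
  exact (Real.exp_pos _).ne'

/-- The limit of the estimator misses the true mean by `gap`. -/
def gap : Fin p → ℝ := fun k => μ k - muStar c ω μ k

/-- The average noise in direction `v`. -/
noncomputable def avgDir (v : Fin p → ℝ) (n : ℕ) (x : Obs p) : ℝ := ∑ k, v k * avgNoise μ n k x

/-- The contribution of observation `n + 1` to the log likelihood ratio for a change at time `1`. -/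
noncomputable def llrIncr (n : ℕ) (x : Obs p) : ℝ :=
  ∑ k, ((muStar c ω μ k + c * avgNoise μ n k x) * x (n + 1) k
    - (muStar c ω μ k + c * avgNoise μ n k x) ^ 2 / 2)

/-- The log likelihood ratio for a change at time `1`. -/
noncomputable def logLR (n : ℕ) (x : Obs p) : ℝ := ∑ j ∈ Finset.Ico 1 n, llrIncr c ω μ j x

theorem estimate_one_succ {n : ℕ} (hn : 1 ≤ n) (x : Obs p) (k : Fin p) :
    estimate c ω x k 1 (n + 1) = muStar c ω μ k + c * avgNoise μ n k x := by
  have hn' : (n : ℝ) ≠ 0 := by positivity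
  have h1 : ∑ i ∈ Finset.Icc 1 n, noise μ i k x = ∑ i ∈ Finset.Ico 1 (n + 1), x i k - n * μ k := by
    unfold noise
    rw [Finset.sum_sub_distrib, Finset.Ico_add_one_right_eq_Icc]
    simp
  unfold estimate avgNoise muStar
  have h2 : ((n + 1 : ℕ) : ℝ) - ((1 : ℕ) : ℝ) = n := by push_cast; ring
  rw [if_neg (by omega), h1, h2, sub_div, mul_div_cancel_left₀ _ hn']
  ring

/-- The first observation meets the estimate 0 and contributes the factor 1, so `n` observations
give `n - 1` increments. -/
theorem plugInLR_one_eq_exp {n : ℕ} (hn : 1 ≤ n) (x : Obs p) :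
    plugInLR c ω n 1 x = Real.exp (logLR c ω μ n x) := by
  induction n, hn using Nat.le_induction with
  | base => simp [plugInLR_self, logLR]
  | succ n hn ih =>
    rw [plugInLR_succ c ω (by omega), ih]
    unfold logLR
    rw [Finset.sum_Ico_succ_top hn, Real.exp_add]
    congr 1
    unfold llrIncr
    rw [Real.exp_sum]
    refine Finset.prod_congr rfl fun k _ => ?_
    rw [estimate_one_succ c ω μ hn, gaussianPDFReal_div_gaussianPDFReal]

/-- The information number `I(μ*, 0; μ)`. -/
noncomputable def infoStar : ℝ := ∑ k, (muStar c ω μ k * μ k - muStar c ω μ k ^ 2 / 2)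

theorem infoNumber_eq : infoNumber (muStar c ω μ) 0 μ = infoStar c ω μ := by
  unfold infoNumber infoStar
  simp only [Pi.zero_apply, gaussianPDFReal_div_gaussianPDFReal, Real.log_exp]
  have hk : ∀ k, HasMoments (obsLaw μ)
      fun y => muStar c ω μ k * y k - muStar c ω μ k ^ 2 / 2 := by
    intro k
    have h : HasMoments (obsLaw μ) fun y => y k := by
      simpa using (hasMoments_obsLaw μ k).add (HasMoments.const (μ k))
    exact (h.const_mul _).sub (HasMoments.const _)
  rw [integral_finsetSum _ fun k _ => (hk k).integrable]
  refine Finset.sum_congr rfl fun k _ => ?_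
  have h : ∀ y : Fin p → ℝ, muStar c ω μ k * y k - muStar c ω μ k ^ 2 / 2
      = muStar c ω μ k * (y k - μ k) + (muStar c ω μ k * μ k - muStar c ω μ k ^ 2 / 2) := by
    intro y; ring
  rw [integral_congr_ae (Filter.Eventually.of_forall h),
    integral_add ((hasMoments_obsLaw μ k).const_mul _).integrable (integrable_const _),
    integral_const_mul, integral_obsLaw_sub, integral_const]
  simp only [probReal_univ, smul_eq_mul]
  ring

/-- The interaction of the average noise with the next observation. -/
noncomputable def avgNext (n : ℕ) (x : Obs p) : ℝ :=
  ∑ k, avgNoise μ n k x * (gap c ω μ k + noise μ (n + 1) k x)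

/-- Expands the square around the limit of the estimator, separating the drift, pure noise, the
coupling of the estimation error with the next observation, and the quadratic loss. -/
theorem llrIncr_eq (n : ℕ) (x : Obs p) :
    llrIncr c ω μ n x = infoStar c ω μ + noiseDir μ (muStar c ω μ) (n + 1) x
      + c * avgNext c ω μ n x - c ^ 2 / 2 * avgSq μ n x := by
  unfold llrIncr infoStar noiseDir avgNext avgSq gap noise
  simp only [Finset.mul_sum]
  rw [← Finset.sum_add_distrib, ← Finset.sum_add_distrib, ← Finset.sum_sub_distrib]
  refine Finset.sum_congr rfl fun k _ => ?_
  ring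

theorem hasMoments_avgDir (v : Fin p → ℝ) (n : ℕ) : HasMoments (lawChange μ 1) (avgDir μ v n) :=
  HasMoments.sum _ fun k _ => (hasMoments_avgNoise μ n k).const_mul _

theorem hasMoments_avgNext (n : ℕ) : HasMoments (lawChange μ 1) (avgNext c ω μ n) :=
  HasMoments.sum _ fun k _ => (hasMoments_avgNoise μ n k).mul
    ((HasMoments.const _).add (hasMoments_noise μ (Nat.le_add_left 1 n) k))

theorem hasMoments_llrIncr (n : ℕ) : HasMoments (lawChange μ 1) (llrIncr c ω μ n) := by
  have h : llrIncr c ω μ n = fun x => infoStar c ω μ + noiseDir μ (muStar c ω μ) (n + 1) x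
      + c * avgNext c ω μ n x - c ^ 2 / 2 * avgSq μ n x := funext (llrIncr_eq c ω μ n)
  rw [h]
  exact (((HasMoments.const _).add (hasMoments_noiseDir μ _ (Nat.le_add_left 1 n))).add
    ((hasMoments_avgNext c ω μ n).const_mul _)).sub ((hasMoments_avgSq μ n).const_mul _)

theorem hasMoments_logLR (n : ℕ) : HasMoments (lawChange μ 1) (logLR c ω μ n) :=
  HasMoments.sum _ fun _ _ => hasMoments_llrIncr c ω μ _

theorem measurable_llrIncr_info {j n : ℕ} (hj : j + 1 ≤ n) :
    Measurable[info p n] (llrIncr c ω μ j) := by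
  refine Finset.measurable_sum _ fun k _ => ?_
  have h1 := ((measurable_avgNoise_info μ (show j ≤ n by omega) k).const_mul c).const_add
    (muStar c ω μ k)
  exact (h1.mul (measurable_obs_apply_info (by omega) hj k)).sub
    ((h1.pow_const 2).div_const 2)

theorem measurable_logLR_info {j n : ℕ} (hj : j ≤ n) :
    Measurable[info p n] (logLR c ω μ j) :=
  Finset.measurable_sum _ fun i hi =>
    measurable_llrIncr_info c ω μ (by have := (Finset.mem_Ico.1 hi).2; omega)

theorem avgDir_sq_le (v : Fin p → ℝ) (n : ℕ) (x : Obs p) :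
    avgDir μ v n x ^ 2 ≤ (∑ k, v k ^ 2) * avgSq μ n x :=
  Finset.sum_mul_sq_le_sq_mul_sq _ _ _

theorem avgNext_sq_le (n : ℕ) (x : Obs p) :
    avgNext c ω μ n x ^ 2 ≤ avgSq μ n x * ∑ k, (gap c ω μ k + (x (n + 1) k - μ k)) ^ 2 :=
  Finset.sum_mul_sq_le_sq_mul_sq _ _ _

section Past

variable {n : ℕ} {A : Set (Obs p)}

theorem measurable_indicator_info (hA : MeasurableSet[info p n] A) :
    Measurable[info p n] (A.indicator (1 : Obs p → ℝ)) :=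
  Measurable.indicator (m := info p n) (@measurable_const _ _ _ (info p n) 1) hA

theorem integral_indicator_mul_noiseDir (hA : MeasurableSet[info p n] A) (v : Fin p → ℝ) :
    ∫ x, A.indicator 1 x * noiseDir μ v (n + 1) x ∂(lawChange μ 1) = 0 := by
  have hm := measurable_indicator_info hA
  have hk : ∀ k, HasMoments (lawChange μ 1)
      fun x => v k * (A.indicator 1 x * noise μ (n + 1) k x) := fun k =>
    ((hasMoments_noise μ (Nat.le_add_left 1 n) k).indicator_mul (info_le n _ hA)).const_mul _
  have e : ∀ x, A.indicator 1 x * noiseDir μ v (n + 1) x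
      = ∑ k, v k * (A.indicator 1 x * noise μ (n + 1) k x) := by
    intro x
    rw [noiseDir, Finset.mul_sum]
    exact Finset.sum_congr rfl fun k _ => by ring
  simp_rw [e]
  rw [integral_finsetSum _ fun k _ => (hk k).integrable]
  refine Finset.sum_eq_zero fun k _ => ?_
  rw [integral_const_mul, integral_past_mul_noise_eq_zero μ n hm, mul_zero]

/-- The next noise is centred given the past, so only the deterministic gap survives. -/
theorem integral_indicator_mul_avgNext (hA : MeasurableSet[info p n] A) :
    ∫ x, A.indicator 1 x * avgNext c ω μ n x ∂(lawChange μ 1)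
      = ∫ x, A.indicator 1 x * avgDir μ (gap c ω μ) n x ∂(lawChange μ 1) := by
  have hm := measurable_indicator_info hA
  have hA' := info_le n _ hA
  have hk : ∀ k, HasMoments (lawChange μ 1)
      fun x => A.indicator 1 x * avgNoise μ n k x * noise μ (n + 1) k x := fun k =>
    ((hasMoments_avgNoise μ n k).indicator_mul hA').mul
      (hasMoments_noise μ (Nat.le_add_left 1 n) k)
  have e : ∀ x, A.indicator 1 x * avgNext c ω μ n x
      = A.indicator 1 x * avgDir μ (gap c ω μ) n x
        + ∑ k, A.indicator 1 x * avgNoise μ n k x * noise μ (n + 1) k x := by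
    intro x
    rw [avgNext, avgDir, Finset.mul_sum, Finset.mul_sum, ← Finset.sum_add_distrib]
    exact Finset.sum_congr rfl fun k _ => by ring
  simp_rw [e]
  rw [integral_add ((hasMoments_avgDir μ _ n).indicator_mul hA').integrable
    (HasMoments.sum Finset.univ fun k _ => hk k).integrable,
    integral_finsetSum _ fun k _ => (hk k).integrable, Finset.sum_eq_zero, add_zero]
  intro k _
  exact integral_past_mul_noise_eq_zero μ n (hm.mul (measurable_avgNoise_info μ le_rfl k)) k

theorem integral_indicator_mul_llrIncr (hA : MeasurableSet[info p n] A) :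
    ∫ x, A.indicator 1 x * llrIncr c ω μ n x ∂(lawChange μ 1)
      = infoStar c ω μ * (lawChange μ 1).real A
        + c * ∫ x, A.indicator 1 x * avgDir μ (gap c ω μ) n x ∂(lawChange μ 1)
        - c ^ 2 / 2 * ∫ x, A.indicator 1 x * avgSq μ n x ∂(lawChange μ 1) := by
  have hA' := info_le n _ hA
  have e : ∀ x, A.indicator 1 x * llrIncr c ω μ n x
      = A.indicator 1 x * infoStar c ω μ
        + A.indicator 1 x * noiseDir μ (muStar c ω μ) (n + 1) x
        + c * (A.indicator 1 x * avgNext c ω μ n x)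
        - c ^ 2 / 2 * (A.indicator 1 x * avgSq μ n x) := by
    intro x; rw [llrIncr_eq]; ring
  have i1 := (HasMoments.const (P := lawChange μ 1) (infoStar c ω μ)).indicator_mul hA'
  have i2 := (hasMoments_noiseDir μ (muStar c ω μ) (Nat.le_add_left 1 n)).indicator_mul hA'
  have i3 := ((hasMoments_avgNext c ω μ n).indicator_mul hA').const_mul c
  have i4 := ((hasMoments_avgSq μ n).indicator_mul hA').const_mul (c ^ 2 / 2)
  simp_rw [e]
  rw [integral_sub ((i1.add i2).add i3).integrable i4.integrable,
    integral_add (i1.add i2).integrable i3.integrable, integral_add i1.integrable i2.integrable,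
    integral_const_mul, integral_const_mul, integral_mul_const, integral_indicator_one hA',
    integral_indicator_mul_noiseDir μ hA, integral_indicator_mul_avgNext c ω μ hA]
  ring

theorem integral_indicator_mul_exp (hA : MeasurableSet[info p n] A) (v : Fin p → ℝ) :
    ∫ x, A.indicator 1 x * Real.exp (noiseDir μ v (n + 1) x) ∂(lawChange μ 1)
      = (lawChange μ 1).real A * Real.exp ((∑ k, v k ^ 2) / 2) := by
  have h := integral_past_mul_noise μ n (measurable_indicator_info hA)
    (H := fun y => Real.exp (∑ k, v k * (y k - μ k))) (by fun_prop)
  rw [integral_obsLaw_exp, integral_indicator_one (info_le n _ hA)] at h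
  exact h

theorem integrable_exp_noiseDir (v : Fin p → ℝ) {i : ℕ} (hi : 1 ≤ i) :
    Integrable (fun x => Real.exp (noiseDir μ v i x)) (lawChange μ 1) := by
  have h := integrable_obsLaw_exp μ v
  rw [← map_eval_lawChange μ hi] at h
  have hm : Measurable fun y : Fin p → ℝ => Real.exp (∑ k, v k * (y k - μ k)) := by fun_prop
  exact (integrable_map_measure (f := fun x : Obs p => x i) hm.aestronglyMeasurable
    (measurable_pi_apply i).aemeasurable).1 h

theorem integrable_indicator_mul {f : Obs p → ℝ} (hf : Integrable f (lawChange μ 1))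
    (hA : MeasurableSet A) : Integrable (fun x => A.indicator 1 x * f x) (lawChange μ 1) := by
  refine (hf.indicator hA).congr (Filter.Eventually.of_forall fun x => ?_)
  by_cases hx : x ∈ A <;> simp [hx]

/-- The mean squared distance of an observation from the limit of the estimator. -/
noncomputable def nextSq : ℝ := ∫ y, ∑ k, (gap c ω μ k + (y k - μ k)) ^ 2 ∂(obsLaw μ)

theorem nextSq_nonneg : 0 ≤ nextSq c ω μ :=
  integral_nonneg fun _ => Finset.sum_nonneg fun _ _ => sq_nonneg _

theorem integral_indicator_mul_avgSq_mul (hA : MeasurableSet[info p n] A) :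
    ∫ x, A.indicator 1 x * avgSq μ n x * ∑ k, (gap c ω μ k + (x (n + 1) k - μ k)) ^ 2
      ∂(lawChange μ 1)
      = (∫ x, A.indicator 1 x * avgSq μ n x ∂(lawChange μ 1)) * nextSq c ω μ :=
  integral_past_mul_noise μ n ((measurable_indicator_info hA).mul (measurable_avgSq_info μ le_rfl))
    (H := fun y => ∑ k, (gap c ω μ k + (y k - μ k)) ^ 2) (by fun_prop)

theorem hasMoments_nextSq (n : ℕ) : HasMoments (lawChange μ 1)
    fun x => ∑ k, (gap c ω μ k + (x (n + 1) k - μ k)) ^ 2 :=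
  HasMoments.sum _ fun k _ =>
    ((HasMoments.const _).add (hasMoments_noise μ (Nat.le_add_left 1 n) k)).pow 2

end Past

/-- The log likelihood ratio stays below `b` from time `m` to time `l`. -/
def survive (b : ℝ) (m l : ℕ) : Set (Obs p) := {x | ∀ j ∈ Finset.Icc m l, logLR c ω μ j x < b}

theorem measurableSet_survive_info (b : ℝ) (m l : ℕ) :
    MeasurableSet[info p l] (survive c ω μ b m l) := by
  have : survive c ω μ b m l = ⋂ j ∈ Finset.Icc m l, {x | logLR c ω μ j x < b} := by
    ext; simp [survive]
  rw [this]
  refine Finset.measurableSet_biInter _ fun j hj => ?_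
  exact measurableSet_lt (measurable_logLR_info c ω μ (Finset.mem_Icc.1 hj).2) measurable_const

theorem measurableSet_survive (b : ℝ) (m l : ℕ) : MeasurableSet (survive c ω μ b m l) :=
  info_le l _ (measurableSet_survive_info c ω μ b m l)

/-- Before the passage the increments telescope to a value of the log likelihood ratio below `b`,
less its value at time `m`. The increment that crosses adds at most `M`. The positive part covers
paths already above `b` at time `m`. -/
theorem sum_indicator_llrIncr_le (b : ℝ) {m : ℕ} (hm : 1 ≤ m) {N : ℕ} (hN : m ≤ N) (x : Obs p)
    {M : ℝ} (hM0 : 0 ≤ M) (hM : ∀ l ∈ Finset.Ico m N,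
      (survive c ω μ b m l).indicator 1 x * llrIncr c ω μ l x ≤ M) :
    ∑ l ∈ Finset.Ico m N, (survive c ω μ b m l).indicator 1 x * llrIncr c ω μ l x
      ≤ max (b - logLR c ω μ m x) 0 + M := by
  induction N, hN using Nat.le_induction with
  | base =>
    simp only [Finset.Ico_self, Finset.sum_empty]
    exact add_nonneg (le_max_right _ _) hM0
  | succ N hN ih =>
    rw [Finset.sum_Ico_succ_top hN]
    by_cases hx : x ∈ survive c ω μ b m N
    · have hsum : ∑ l ∈ Finset.Ico m N, (survive c ω μ b m l).indicator 1 x * llrIncr c ω μ l x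
          = logLR c ω μ N x - logLR c ω μ m x := by
        unfold logLR
        rw [← Finset.sum_Ico_consecutive _ hm hN, add_sub_cancel_left]
        refine Finset.sum_congr rfl fun l hl => ?_
        rw [Finset.mem_Ico] at hl
        have : x ∈ survive c ω μ b m l := fun j hj => hx j (Finset.mem_Icc.2
          ⟨(Finset.mem_Icc.1 hj).1, (Finset.mem_Icc.1 hj).2.trans hl.2.le⟩)
        rw [Set.indicator_of_mem this]
        simp
      have h1 : logLR c ω μ N x < b := hx N (Finset.mem_Icc.2 ⟨hN, le_rfl⟩)
      have h2 := hM N (Finset.mem_Ico.2 ⟨hN, N.lt_succ_self⟩)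
      have h3 := le_max_left (b - logLR c ω μ m x) 0
      rw [hsum]
      linarith
    · rw [Set.indicator_of_notMem hx, zero_mul, add_zero]
      exact ih fun l hl => hM l (Finset.mem_Ico.2
        ⟨(Finset.mem_Ico.1 hl).1, (Finset.mem_Ico.1 hl).2.trans N.lt_succ_self⟩)

/-- A bound for all log likelihood ratio increments before the passage. -/
noncomputable def overshoot (b : ℝ) (m N : ℕ) (t K : ℝ) (x : Obs p) : ℝ :=
  infoStar c ω μ + 1
    + (Real.log K + (∑ l ∈ Finset.Ico m N, (survive c ω μ b m l).indicator 1 x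
        * Real.exp (noiseDir μ (fun k => t * muStar c ω μ k) (l + 1) x)) / K) / t
    + c ^ 2 * ∑ l ∈ Finset.Ico m N, (survive c ω μ b m l).indicator 1 x * avgSq μ l x
        * ∑ k, (gap c ω μ k + (x (l + 1) k - μ k)) ^ 2

theorem indicator_one_nonneg {Ω : Type*} (A : Set Ω) (x : Ω) :
    (0 : ℝ) ≤ A.indicator (1 : Ω → ℝ) x :=
  Set.indicator_nonneg (fun _ _ => zero_le_one) x

theorem overshoot_nonneg (hI : 0 ≤ infoStar c ω μ) (b : ℝ) (m N : ℕ) {t K : ℝ} (ht : 0 < t)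
    (hK : 1 ≤ K) (x : Obs p) : 0 ≤ overshoot c ω μ b m N t K x := by
  unfold overshoot
  have h1 := Real.log_nonneg hK
  have h2 : 0 ≤ ∑ l ∈ Finset.Ico m N, (survive c ω μ b m l).indicator (1 : Obs p → ℝ) x
        * Real.exp (noiseDir μ (fun k => t * muStar c ω μ k) (l + 1) x) :=
    Finset.sum_nonneg fun l _ => mul_nonneg (indicator_one_nonneg _ _) (Real.exp_pos _).le
  have h3 : 0 ≤ ∑ l ∈ Finset.Ico m N, (survive c ω μ b m l).indicator (1 : Obs p → ℝ) x
      * avgSq μ l x * ∑ k, (gap c ω μ k + (x (l + 1) k - μ k)) ^ 2 :=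
    Finset.sum_nonneg fun l _ => mul_nonneg
      (mul_nonneg (indicator_one_nonneg _ _) (avgSq_nonneg _ _ _))
      (Finset.sum_nonneg fun _ _ => sq_nonneg _)
  positivity

/-- A maximum over times is replaced by a sum of nonnegative terms: exponentials for the pure noise,
squares for the coupling term. The quadratic loss has the favourable sign and is dropped. -/
theorem indicator_mul_llrIncr_le_overshoot (hI : 0 ≤ infoStar c ω μ) (b : ℝ) {m N l : ℕ}
    (hl : l ∈ Finset.Ico m N) {t K : ℝ} (ht : 0 < t) (hK : 1 ≤ K) (x : Obs p) :
    (survive c ω μ b m l).indicator 1 x * llrIncr c ω μ l x ≤ overshoot c ω μ b m N t K x := by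
  by_cases hx : x ∈ survive c ω μ b m l
  swap
  · rw [Set.indicator_of_notMem hx, zero_mul]
    exact overshoot_nonneg c ω μ hI b m N ht hK x
  have h2 := Finset.single_le_sum (f := fun l => (survive c ω μ b m l).indicator (1 : Obs p → ℝ) x
        * Real.exp (noiseDir μ (fun k => t * muStar c ω μ k) (l + 1) x))
    (fun l _ => mul_nonneg (indicator_one_nonneg _ _) (Real.exp_pos _).le) hl
  have h3 := Finset.single_le_sum (f := fun l => (survive c ω μ b m l).indicator (1 : Obs p → ℝ) x
      * avgSq μ l x * ∑ k, (gap c ω μ k + (x (l + 1) k - μ k)) ^ 2)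
    (fun l _ => mul_nonneg (mul_nonneg (indicator_one_nonneg _ _) (avgSq_nonneg _ _ _))
      (Finset.sum_nonneg fun _ _ => sq_nonneg _)) hl
  simp only [Set.indicator_of_mem hx, Pi.one_apply, one_mul] at h2 h3 ⊢
  have hdir : noiseDir μ (fun k => t * muStar c ω μ k) (l + 1) x
      = t * noiseDir μ (muStar c ω μ) (l + 1) x := by
    unfold noiseDir
    rw [Finset.mul_sum]
    exact Finset.sum_congr rfl fun k _ => by ring
  rw [hdir] at h2
  have hK0 : 0 < K := by linarith
  -- From `s - log K + 1 ≤ exp (s - log K)`. With `K` comparable to the mean survival time, the mean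
  -- of the right side is about `(log K) / t`.
  have h4 : noiseDir μ (muStar c ω μ) (l + 1) x ≤ (Real.log K + (∑ l ∈ Finset.Ico m N,
      (survive c ω μ b m l).indicator 1 x
        * Real.exp (noiseDir μ (fun k => t * muStar c ω μ k) (l + 1) x)) / K) / t := by
    rw [le_div_iff₀ ht, mul_comm]
    set s := t * noiseDir μ (muStar c ω μ) (l + 1) x with hs
    have h5 := Real.add_one_le_exp (s - Real.log K)
    rw [Real.exp_sub, Real.exp_log hK0] at h5
    have h6 := div_le_div_of_nonneg_right h2 hK0.le
    linarith
  have h5 := avgNext_sq_le c ω μ l x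
  have h6 : c * avgNext c ω μ l x ≤ 1 + c ^ 2 * avgNext c ω μ l x ^ 2 := by
    nlinarith [sq_nonneg (c * avgNext c ω μ l x - 1), sq_nonneg (c * avgNext c ω μ l x)]
  have h7 : c ^ 2 * avgNext c ω μ l x ^ 2 ≤ c ^ 2 * ∑ l ∈ Finset.Ico m N,
      (survive c ω μ b m l).indicator 1 x * avgSq μ l x
        * ∑ k, (gap c ω μ k + (x (l + 1) k - μ k)) ^ 2 :=
    mul_le_mul_of_nonneg_left (h5.trans h3) (sq_nonneg c)
  have h8 : 0 ≤ c ^ 2 / 2 * avgSq μ l x := mul_nonneg (by positivity) (avgSq_nonneg _ _ _)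
  rw [llrIncr_eq]
  unfold overshoot
  linarith

/-- The mean time, up to time `N`, that the log likelihood ratio stays below `b` from `m` on. -/
noncomputable def meanSurvival (b : ℝ) (m N : ℕ) : ℝ :=
  ∑ l ∈ Finset.Ico m N, (lawChange μ 1).real (survive c ω μ b m l)

/-- The mean of the accumulated squared estimation errors before the passage. -/
noncomputable def meanSqError (b : ℝ) (m N : ℕ) : ℝ :=
  ∑ l ∈ Finset.Ico m N, ∫ x, (survive c ω μ b m l).indicator 1 x * avgSq μ l x ∂(lawChange μ 1)

/-- The mean of the accumulated linear estimation errors before the passage. -/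
noncomputable def meanLinError (b : ℝ) (m N : ℕ) : ℝ :=
  ∑ l ∈ Finset.Ico m N, ∫ x, (survive c ω μ b m l).indicator 1 x
    * |avgDir μ (gap c ω μ) l x| ∂(lawChange μ 1)

theorem integrable_overshoot_and_integral (b : ℝ) (m N : ℕ) (t K : ℝ) :
    Integrable (overshoot c ω μ b m N t K) (lawChange μ 1) ∧
    ∫ x, overshoot c ω μ b m N t K x ∂(lawChange μ 1)
      = infoStar c ω μ + 1
        + (Real.log K + (meanSurvival c ω μ b m N
            * Real.exp (t ^ 2 * (∑ k, muStar c ω μ k ^ 2) / 2)) / K) / t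
        + c ^ 2 * (meanSqError c ω μ b m N * nextSq c ω μ) := by
  have hA := measurableSet_survive c ω μ b m
  have j1 : ∀ l, Integrable (fun x => (survive c ω μ b m l).indicator 1 x
        * Real.exp (noiseDir μ (fun k => t * muStar c ω μ k) (l + 1) x)) (lawChange μ 1) :=
    fun l => integrable_indicator_mul μ (integrable_exp_noiseDir μ _ (Nat.le_add_left 1 l)) (hA l)
  have j2 : ∀ l, Integrable (fun x => (survive c ω μ b m l).indicator 1 x * avgSq μ l x
        * ∑ k, (gap c ω μ k + (x (l + 1) k - μ k)) ^ 2) (lawChange μ 1) :=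
    fun l => (((hasMoments_avgSq μ l).indicator_mul (hA l)).mul
      (hasMoments_nextSq c ω μ l)).integrable
  have i1 := integrable_const (μ := lawChange μ 1) (infoStar c ω μ + 1)
  have i2 := ((integrable_const (μ := lawChange μ 1) (Real.log K)).add
    ((integrable_finsetSum (Finset.Ico m N) fun l _ => j1 l).div_const K)).div_const t
  have i3 := (integrable_finsetSum (Finset.Ico m N) fun l _ => j2 l).const_mul (c ^ 2)
  refine ⟨(i1.add i2).add i3, ?_⟩
  have h1 : ∫ x, ∑ l ∈ Finset.Ico m N, (survive c ω μ b m l).indicator 1 x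
        * Real.exp (noiseDir μ (fun k => t * muStar c ω μ k) (l + 1) x) ∂(lawChange μ 1)
      = meanSurvival c ω μ b m N * Real.exp (t ^ 2 * (∑ k, muStar c ω μ k ^ 2) / 2) := by
    rw [integral_finsetSum _ fun l _ => j1 l, meanSurvival, Finset.sum_mul]
    refine Finset.sum_congr rfl fun l _ => ?_
    rw [integral_indicator_mul_exp μ (measurableSet_survive_info c ω μ b m l)]
    simp_rw [mul_pow]
    rw [← Finset.mul_sum]
  have h2 : ∫ x, ∑ l ∈ Finset.Ico m N, (survive c ω μ b m l).indicator 1 x * avgSq μ l x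
        * ∑ k, (gap c ω μ k + (x (l + 1) k - μ k)) ^ 2 ∂(lawChange μ 1)
      = meanSqError c ω μ b m N * nextSq c ω μ := by
    rw [integral_finsetSum _ fun l _ => j2 l, meanSqError, Finset.sum_mul]
    exact Finset.sum_congr rfl fun l _ =>
      integral_indicator_mul_avgSq_mul c ω μ (measurableSet_survive_info c ω μ b m l)
  calc _ = ∫ x, (infoStar c ω μ + 1) ∂(lawChange μ 1) + _ + _ :=
        (integral_add (i1.add i2) i3).trans (congrArg (· + _) (integral_add i1 i2))
    _ = _ := by
      rw [integral_div, integral_add' (integrable_const _)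
          ((integrable_finsetSum (Finset.Ico m N) fun l _ => j1 l).div_const K),
        integral_const_mul, integral_div, h1, h2]
      simp

/-- Wald's identity for the log likelihood ratio after time `m`, as an inequality. -/
theorem infoStar_mul_meanSurvival_le (hc : 0 ≤ c) (hI : 0 ≤ infoStar c ω μ) (b : ℝ) {m N : ℕ}
    (hm : 1 ≤ m) (hN : m ≤ N) {t K : ℝ} (ht : 0 < t) (hK : 1 ≤ K) :
    infoStar c ω μ * meanSurvival c ω μ b m N
      ≤ (∫ x, max (b - logLR c ω μ m x) 0 ∂(lawChange μ 1))
        + (infoStar c ω μ + 1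
        + (Real.log K + (meanSurvival c ω μ b m N
            * Real.exp (t ^ 2 * (∑ k, muStar c ω μ k ^ 2) / 2)) / K) / t
        + c ^ 2 * (meanSqError c ω μ b m N * nextSq c ω μ))
        + c ^ 2 / 2 * meanSqError c ω μ b m N + c * meanLinError c ω μ b m N := by
  obtain ⟨hO, hOi⟩ := integrable_overshoot_and_integral c ω μ b m N t K
  have hA := measurableSet_survive c ω μ b m
  have j1 : ∀ l, HasMoments (lawChange μ 1) fun x =>
      (survive c ω μ b m l).indicator 1 x * llrIncr c ω μ l x :=
    fun l => (hasMoments_llrIncr c ω μ l).indicator_mul (hA l)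
  have j2 : HasMoments (lawChange μ 1) fun x => max (b - logLR c ω μ m x) 0 :=
    ((HasMoments.const b).sub (hasMoments_logLR c ω μ m)).max_zero
  have h1 := integral_mono (HasMoments.sum (Finset.Ico m N) fun l _ => j1 l).integrable
    (j2.integrable.add hO) (fun x => sum_indicator_llrIncr_le c ω μ b hm hN x
      (overshoot_nonneg c ω μ hI b m N ht hK x)
      fun l hl => indicator_mul_llrIncr_le_overshoot c ω μ hI b hl ht hK x)
  rw [integral_add' j2.integrable hO, hOi, integral_finsetSum _ fun l _ => (j1 l).integrable] at h1
  simp_rw [fun l => integral_indicator_mul_llrIncr c ω μ (measurableSet_survive_info c ω μ b m l)]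
    at h1
  rw [Finset.sum_sub_distrib, Finset.sum_add_distrib, ← Finset.mul_sum, ← Finset.mul_sum,
    ← Finset.mul_sum] at h1
  -- Survival is correlated with the estimation error in an unknown way, so the linear term is
  -- bounded by its absolute value.
  have h2 : -meanLinError c ω μ b m N ≤ ∑ l ∈ Finset.Ico m N, ∫ x,
      (survive c ω μ b m l).indicator 1 x * avgDir μ (gap c ω μ) l x ∂(lawChange μ 1) := by
    rw [meanLinError, ← Finset.sum_neg_distrib]
    refine Finset.sum_le_sum fun l _ => ?_
    rw [← integral_neg]
    refine integral_mono ((hasMoments_avgDir μ _ l).abs.indicator_mul (hA l)).integrable.neg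
      ((hasMoments_avgDir μ _ l).indicator_mul (hA l)).integrable fun x => ?_
    have := mul_le_mul_of_nonneg_left (neg_abs_le (avgDir μ (gap c ω μ) l x))
      (indicator_one_nonneg (survive c ω μ b m l) x)
    beta_reduce
    linarith
  have h3 := mul_le_mul_of_nonneg_left h2 hc
  simp only [meanSurvival, meanSqError] at h1 ⊢
  linarith

end SRRS

/-! ### Accumulated estimation errors, a crude passage bound and the mean drift -/

namespace SRRS

variable {p : ℕ} (c : ℝ) (ω μ : Fin p → ℝ)

theorem sum_Ico_inv_sq_le {m N : ℕ} (hm : 1 ≤ m) (hN : m ≤ N) :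
    ∑ l ∈ Finset.Ico m N, 1 / (l : ℝ) ^ 2 ≤ 2 / (m : ℝ) - 2 / (N : ℝ) := by
  induction N, hN using Nat.le_induction with
  | base => simp
  | succ N hN ih =>
    rw [Finset.sum_Ico_succ_top hN]
    have hN0 : (1 : ℝ) ≤ N := by exact_mod_cast hm.trans hN
    have h : 1 / (N : ℝ) ^ 2 ≤ 2 / N - 2 / ((N + 1 : ℕ) : ℝ) := by
      push_cast
      rw [div_sub_div _ _ (by positivity) (by positivity),
        div_le_div_iff₀ (by positivity) (by positivity)]
      nlinarith
    linarith

theorem sum_Ico_inv_le {n : ℕ} (hn : 1 ≤ n) :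
    ∑ j ∈ Finset.Ico 1 n, 1 / (j : ℝ) ≤ 1 + Real.log n := by
  have h : ∑ j ∈ Finset.Ico 1 (n + 1), 1 / (j : ℝ) ≤ 1 + Real.log n := by
    induction n, hn using Nat.le_induction with
    | base => simp
    | succ n hn ih =>
      rw [Finset.sum_Ico_succ_top (by omega)]
      have hn0 : (0 : ℝ) < n := by exact_mod_cast hn
      have h1 := Real.log_le_sub_one_of_pos (x := (n : ℝ) / ((n + 1 : ℕ) : ℝ)) (by positivity)
      rw [Real.log_div hn0.ne' (by positivity)] at h1
      have h2 : (n : ℝ) / ((n + 1 : ℕ) : ℝ) - 1 = -(1 / ((n + 1 : ℕ) : ℝ)) := by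
        push_cast; field_simp; ring
      linarith
  rw [Finset.sum_Ico_succ_top hn] at h
  have : 0 ≤ 1 / (n : ℝ) := by positivity
  linarith

variable (b : ℝ)

theorem meanSurvival_nonneg (m N : ℕ) : 0 ≤ meanSurvival c ω μ b m N :=
  Finset.sum_nonneg fun _ _ => measureReal_nonneg

theorem indicator_one_le_one {Ω : Type*} (A : Set Ω) (x : Ω) :
    A.indicator (1 : Ω → ℝ) x ≤ 1 :=
  Set.indicator_le_self' (fun _ _ => zero_le_one) x

/-- Uses `a ≤ (m / 2) a² + 1 / (2 m)` for `a = avgSq`. The first part sums to a constant, since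
second moments decay like `1 / l²` and `∑_{l ≥ m} 1 / l² ≤ 2 / m`. The second is paid only while
surviving. -/
theorem meanSqError_le : ∃ C : ℝ, 0 ≤ C ∧ ∀ (b : ℝ) (m N : ℕ), 1 ≤ m → m ≤ N →
    meanSqError c ω μ b m N ≤ C + meanSurvival c ω μ b m N / (2 * m) := by
  obtain ⟨C, hC0, hC⟩ := integral_avgSq_sq_le μ
  refine ⟨C, hC0, fun b m N hm hN => ?_⟩
  have hA := measurableSet_survive c ω μ b m
  have hm0 : (0 : ℝ) < m := by exact_mod_cast hm
  have hterm : ∀ l ∈ Finset.Ico m N,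
      ∫ x, (survive c ω μ b m l).indicator 1 x * avgSq μ l x ∂(lawChange μ 1)
        ≤ m / 2 * C * (1 / (l : ℝ) ^ 2)
          + (lawChange μ 1).real (survive c ω μ b m l) * (1 / (2 * m)) := by
    intro l hl
    have hl1 : 1 ≤ l := hm.trans (Finset.mem_Ico.1 hl).1
    have i1 := ((hasMoments_avgSq μ l).pow 2).const_mul (m / 2)
    have i2 := (HasMoments.const (P := lawChange μ 1) (1 / (2 * (m : ℝ)))).indicator_mul (hA l)
    have h1 := integral_mono ((hasMoments_avgSq μ l).indicator_mul (hA l)).integrable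
      (i1.add i2).integrable fun x => by
        have h2 : avgSq μ l x ≤ m / 2 * avgSq μ l x ^ 2 + 1 / (2 * m) := by
          have : m / 2 * avgSq μ l x ^ 2 + 1 / (2 * (m : ℝ)) - avgSq μ l x
              = (m * avgSq μ l x - 1) ^ 2 / (2 * m) := by
            field_simp; ring
          have h3 : 0 ≤ (m * avgSq μ l x - 1) ^ 2 / (2 * (m : ℝ)) := by positivity
          linarith
        have h3 : 0 ≤ (m : ℝ) / 2 * avgSq μ l x ^ 2 := by positivity
        by_cases hx : x ∈ survive c ω μ b m l
        · simpa [Set.indicator_of_mem hx] using h2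
        · simpa [Set.indicator_of_notMem hx] using h3
    rw [integral_add i1.integrable i2.integrable, integral_const_mul, integral_mul_const,
      integral_indicator_one (hA l)] at h1
    refine h1.trans (add_le_add ?_ le_rfl)
    have h4 := mul_le_mul_of_nonneg_left (hC l hl1) (show (0 : ℝ) ≤ m / 2 by positivity)
    calc _ ≤ _ := h4
      _ = _ := by ring
  have h1 := Finset.sum_le_sum hterm
  rw [Finset.sum_add_distrib, ← Finset.mul_sum, ← Finset.sum_mul] at h1
  have h2 := sum_Ico_inv_sq_le hm hN
  have h3 : ∑ l ∈ Finset.Ico m N, 1 / (l : ℝ) ^ 2 ≤ 2 / (m : ℝ) := by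
    have : (0 : ℝ) ≤ 2 / N := by positivity
    linarith
  have h4 : m / 2 * C * ∑ l ∈ Finset.Ico m N, 1 / (l : ℝ) ^ 2 ≤ C := by
    calc _ ≤ m / 2 * C * (2 / m) := mul_le_mul_of_nonneg_left h3 (by positivity)
      _ = C := by field_simp
  have h5 : meanSurvival c ω μ b m N / (2 * m)
      = (∑ l ∈ Finset.Ico m N, (lawChange μ 1).real (survive c ω μ b m l)) * (1 / (2 * m)) := by
    rw [meanSurvival]; ring
  rw [h5]
  unfold meanSqError
  linarith

/-- By `c |d| ≤ I / 4 + c² d² / I` and Cauchy–Schwarz. A quarter of the drift pays for the linear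
error. -/
theorem mul_meanLinError_le (hI : 0 < infoStar c ω μ) (m N : ℕ) :
    c * meanLinError c ω μ b m N ≤ infoStar c ω μ / 4 * meanSurvival c ω μ b m N
      + c ^ 2 * (∑ k, gap c ω μ k ^ 2) / infoStar c ω μ * meanSqError c ω μ b m N := by
  unfold meanLinError meanSurvival meanSqError
  rw [Finset.mul_sum, Finset.mul_sum, Finset.mul_sum, ← Finset.sum_add_distrib]
  refine Finset.sum_le_sum fun l _ => ?_
  have hA := measurableSet_survive c ω μ b m l
  have i1 := (HasMoments.const (P := lawChange μ 1) (infoStar c ω μ / 4)).indicator_mul hA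
  have i2 := ((hasMoments_avgSq μ l).indicator_mul hA).const_mul
    (c ^ 2 * (∑ k, gap c ω μ k ^ 2) / infoStar c ω μ)
  have h1 := integral_mono
    (((hasMoments_avgDir μ (gap c ω μ) l).abs.indicator_mul hA).const_mul c).integrable
    (i1.add i2).integrable fun x => by
      have h2 := avgDir_sq_le μ (gap c ω μ) l x
      set d := avgDir μ (gap c ω μ) l x
      set I := infoStar c ω μ
      have h3 : c * |d| ≤ I / 4 + c ^ 2 * d ^ 2 / I := by
        have : I / 4 + c ^ 2 * d ^ 2 / I - c * |d| = (c * |d| - I / 2) ^ 2 / I := by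
          rw [← sq_abs d]; field_simp; ring
        have h4 : 0 ≤ (c * |d| - I / 2) ^ 2 / I := by positivity
        linarith
      have h4 : c ^ 2 * d ^ 2 / I ≤ c ^ 2 * (∑ k, gap c ω μ k ^ 2) / I * avgSq μ l x := by
        rw [div_mul_eq_mul_div, mul_assoc]
        gcongr
      by_cases hx : x ∈ survive c ω μ b m l
      · simp only [Set.indicator_of_mem hx, Pi.one_apply, one_mul]
        linarith
      · simp [Set.indicator_of_notMem hx]
  rw [integral_add i1.integrable i2.integrable, integral_const_mul, integral_mul_const,
    integral_const_mul, integral_indicator_one hA] at h1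
  linarith

/-- A crude bound for the mean time after `m` that the log likelihood ratio needs to reach `b`. -/
theorem meanSurvival_le (hc : 0 ≤ c) (hI : 0 < infoStar c ω μ) :
    ∃ (C : ℝ) (m₀ : ℕ), 0 ≤ C ∧ 1 ≤ m₀ ∧ ∀ (b : ℝ) (m N : ℕ), m₀ ≤ m → m ≤ N →
      meanSurvival c ω μ b m N
        ≤ C * ((∫ x, max (b - logLR c ω μ m x) 0 ∂(lawChange μ 1)) + 1) := by
  obtain ⟨C₁, hC₁, hsq⟩ := meanSqError_le c ω μ
  set I := infoStar c ω μ with hId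
  set G := c ^ 2 * nextSq c ω μ + c ^ 2 / 2 + c ^ 2 * (∑ k, gap c ω μ k ^ 2) / I with hG
  have hG0 : 0 ≤ G := by
    have h1 := nextSq_nonneg c ω μ
    positivity
  set M := Real.exp (1 ^ 2 * (∑ k, muStar c ω μ k ^ 2) / 2) with hM
  have hM0 : 0 < M := Real.exp_pos _
  -- Chosen so that the exponential part of the overshoot costs at most an eighth of the drift. From
  -- `m₀` on, the squared errors cost another eighth. With the quarter for the linear errors, half
  -- of the drift remains.
  set K := 1 + 8 * M / I with hK
  have hK1 : 1 ≤ K := by have : 0 ≤ 8 * M / I := by positivity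
                         linarith
  have hMK : M / K ≤ I / 8 := by
    rw [div_le_iff₀ (by linarith), hK]
    field_simp
    nlinarith
  set m₀ := max 1 ⌈4 * G / I⌉₊ with hm₀
  have hlogK := Real.log_nonneg hK1
  set E := I + 1 + Real.log K + G * C₁ with hE
  have hE1 : 1 ≤ E := by
    have : 0 ≤ G * C₁ := by positivity
    linarith
  refine ⟨2 / I * E, m₀, by positivity, le_max_left _ _, fun b m N hm hN => ?_⟩
  have hm1 : 1 ≤ m := (le_max_left _ _).trans hm
  have hmG : 4 * G / I ≤ m := (Nat.le_ceil _).trans (by exact_mod_cast (le_max_right _ _).trans hm)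
  have hm0 : (0 : ℝ) < m := by exact_mod_cast hm1
  have h1 := infoStar_mul_meanSurvival_le c ω μ hc hI.le b hm1 hN one_pos hK1
  have h2 := mul_meanLinError_le c ω μ b hI m N
  have h3 := hsq b m N hm1 hN
  rw [← hM, ← hId] at h1
  rw [← hId] at h2
  set u := meanSurvival c ω μ b m N
  set Q := meanSqError c ω μ b m N
  set R := ∫ x, max (b - logLR c ω μ m x) 0 ∂(lawChange μ 1)
  have hR : 0 ≤ R := integral_nonneg fun x => le_max_right _ _
  have hu : 0 ≤ u := meanSurvival_nonneg c ω μ b m N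
  have h4 : u * M / K ≤ I / 8 * u := by
    rw [mul_div_assoc, mul_comm]
    exact mul_le_mul_of_nonneg_right hMK hu
  have h5 : G * Q ≤ G * C₁ + I / 8 * u := by
    have h6 : G * (u / (2 * m)) ≤ I / 8 * u := by
      rw [div_le_iff₀ hI] at hmG
      rw [← mul_div_assoc, div_le_iff₀ (by positivity)]
      nlinarith
    have h7 := mul_le_mul_of_nonneg_left h3 hG0
    linarith
  have h6 : I * u ≤ R + E + I / 2 * u := by
    have : G * Q = c ^ 2 * (Q * nextSq c ω μ) + c ^ 2 / 2 * Q
        + c ^ 2 * (∑ k, gap c ω μ k ^ 2) / I * Q := by rw [hG]; ring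
    rw [div_one] at h1
    linarith
  have h7 : u ≤ 2 / I * (R + E) := by
    rw [div_mul_eq_mul_div, le_div_iff₀ hI]
    linarith
  refine h7.trans ?_
  rw [mul_assoc]
  refine mul_le_mul_of_nonneg_left ?_ (by positivity)
  nlinarith

theorem survive_anti {m m' : ℕ} (h : m ≤ m') (l : ℕ) :
    survive c ω μ b m l ⊆ survive c ω μ b m' l := fun _ hx j hj =>
  hx j (Finset.mem_Icc.2 ⟨h.trans (Finset.mem_Icc.1 hj).1, (Finset.mem_Icc.1 hj).2⟩)

theorem integral_abs_avgDir_le (v : Fin p → ℝ) {n l : ℕ} (hn : 1 ≤ n) (hl : n ≤ l) :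
    ∫ x, |avgDir μ v l x| ∂(lawChange μ 1) ≤ ((∑ k, v k ^ 2) * p + 1) / √n := by
  have hn0 : (0 : ℝ) < n := by exact_mod_cast hn
  have hl0 : (0 : ℝ) < l := by exact_mod_cast hn.trans hl
  have hs : 0 < √(n : ℝ) := Real.sqrt_pos.2 hn0
  have i1 := (hasMoments_avgSq μ l).const_mul (√n * ∑ k, v k ^ 2)
  have i2 := HasMoments.const (P := lawChange μ 1) (1 / √n)
  have h1 := integral_mono (hasMoments_avgDir μ v l).abs.integrable (i1.add i2).integrable
    fun x => by
      have h2 := mul_le_mul_of_nonneg_left (avgDir_sq_le μ v l x) hs.le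
      have h3 : |avgDir μ v l x| ≤ √n * avgDir μ v l x ^ 2 + 1 / √n := by
        rw [← sq_abs (avgDir μ v l x)]
        set d := |avgDir μ v l x|
        have : √n * d ^ 2 + 1 / √n - d = ((√n * d - 1 / 2) ^ 2 + 3 / 4) / √n := by
          field_simp; ring
        have h4 : 0 ≤ ((√n * d - 1 / 2) ^ 2 + 3 / 4) / √n := by positivity
        linarith
      linarith
  rw [integral_add i1.integrable i2.integrable, integral_const_mul, integral_avgSq μ (hn.trans hl)]
    at h1
  simp only [integral_const, probReal_univ, one_smul] at h1
  refine h1.trans ?_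
  rw [add_div]
  refine add_le_add ?_ le_rfl
  have hG : 0 ≤ ∑ k, v k ^ 2 := Finset.sum_nonneg fun _ _ => sq_nonneg _
  calc √n * (∑ k, v k ^ 2) * (p / l) ≤ √n * (∑ k, v k ^ 2) * (p / n) := by
        gcongr
    _ = _ := by
        nth_rewrite 2 [← Real.sq_sqrt hn0.le]
        field_simp

/-- Inside the window survival is ignored and each term costs its unconditional mean of order `1 /
√n₁`. Beyond `n₂` survival is only demanded from `n₂` on. -/
theorem meanLinError_le {n₁ n₂ N : ℕ} (h1 : 1 ≤ n₁) (h2 : n₁ ≤ n₂) (hN : n₂ ≤ N) :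
    meanLinError c ω μ b n₁ N ≤
      (n₂ - n₁) * (((∑ k, gap c ω μ k ^ 2) * p + 1) / √n₁) + meanLinError c ω μ b n₂ N := by
  have hd := fun l => (hasMoments_avgDir μ (gap c ω μ) l).abs
  have hA := fun m l => measurableSet_survive c ω μ b m l
  unfold meanLinError
  rw [← Finset.sum_Ico_consecutive _ h2 hN]
  refine add_le_add ?_ (Finset.sum_le_sum fun l _ => ?_)
  · have h3 := Finset.sum_le_card_nsmul (Finset.Ico n₁ n₂)
      (fun l => ∫ x, (survive c ω μ b n₁ l).indicator 1 x
        * |avgDir μ (gap c ω μ) l x| ∂(lawChange μ 1))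
      (((∑ k, gap c ω μ k ^ 2) * p + 1) / √n₁) fun l hl => by
        refine (integral_mono ((hd l).indicator_mul (hA n₁ l)).integrable (hd l).integrable
          fun x => ?_).trans (integral_abs_avgDir_le μ _ h1 (Finset.mem_Ico.1 hl).1)
        exact mul_le_of_le_one_left (abs_nonneg _) (indicator_one_le_one _ _)
    rw [Nat.card_Ico, nsmul_eq_mul, Nat.cast_sub h2] at h3
    exact h3
  · refine integral_mono ((hd l).indicator_mul (hA n₁ l)).integrable
      ((hd l).indicator_mul (hA n₂ l)).integrable fun x => ?_
    exact mul_le_mul_of_nonneg_right (Set.indicator_le_indicator_of_subset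
      (survive_anti c ω μ b h2 l) (fun _ => zero_le_one) x) (abs_nonneg _)

theorem integral_avgDir {n : ℕ} (v : Fin p → ℝ) : ∫ x, avgDir μ v n x ∂(lawChange μ 1) = 0 := by
  unfold avgDir
  rw [integral_finsetSum _ fun k _ => ((hasMoments_avgNoise μ n k).const_mul _).integrable]
  refine Finset.sum_eq_zero fun k _ => ?_
  unfold avgNoise
  rw [integral_const_mul, integral_div, integral_sum_noise]
  simp

/-- At a deterministic time the linear errors have mean zero, so the quadratic loss is the only
correction to the drift. -/
theorem integral_logLR {n : ℕ} (hn : 1 ≤ n) :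
    ∫ x, logLR c ω μ n x ∂(lawChange μ 1) = infoStar c ω μ * (n - 1)
      - c ^ 2 * p / 2 * ∑ j ∈ Finset.Ico 1 n, 1 / (j : ℝ) := by
  unfold logLR
  rw [integral_finsetSum _ fun j _ => (hasMoments_llrIncr c ω μ j).integrable]
  have h : ∀ j ∈ Finset.Ico 1 n, ∫ x, llrIncr c ω μ j x ∂(lawChange μ 1)
      = infoStar c ω μ - c ^ 2 * p / 2 * (1 / (j : ℝ)) := by
    intro j hj
    have h1 := integral_indicator_mul_llrIncr c ω μ (n := j) (A := Set.univ) MeasurableSet.univ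
    simp only [Set.indicator_univ, Pi.one_apply, one_mul, integral_avgDir,
      integral_avgSq μ (Finset.mem_Ico.1 hj).1, probReal_univ] at h1
    rw [h1]; ring
  rw [Finset.sum_congr rfl h, Finset.sum_sub_distrib, ← Finset.mul_sum]
  simp [Nat.cast_sub hn, mul_comm]

end SRRS

/-! ### Concentration of the log likelihood ratio about its drift -/

namespace SRRS

variable {p : ℕ} (c : ℝ) (ω μ : Fin p → ℝ)

/-- The total noise up to time `n` in direction `v`. -/
def sumDir (v : Fin p → ℝ) (n : ℕ) (x : Obs p) : ℝ := ∑ i ∈ Finset.Icc 1 n, noiseDir μ v i x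

theorem avgDir_eq_sumDir_div (v : Fin p → ℝ) (n : ℕ) (x : Obs p) :
    avgDir μ v n x = sumDir μ v n x / n := by
  unfold avgDir sumDir noiseDir avgNoise
  rw [Finset.sum_comm, Finset.sum_div]
  refine Finset.sum_congr rfl fun k _ => ?_
  rw [← Finset.mul_sum, mul_div_assoc]

theorem hasMoments_sumDir (v : Fin p → ℝ) (n : ℕ) : HasMoments (lawChange μ 1) (sumDir μ v n) :=
  HasMoments.sum _ fun _ hi => hasMoments_noiseDir μ v (Finset.mem_Icc.1 hi).1

theorem measurable_sumDir_info (v : Fin p → ℝ) (n : ℕ) :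
    Measurable[info p n] (sumDir μ v n) :=
  Finset.measurable_sum _ fun _ hi => Finset.measurable_sum _ fun k _ =>
    (measurable_noise_info μ (Finset.mem_Icc.1 hi).1 (Finset.mem_Icc.1 hi).2 k).const_mul _

theorem integral_exp_sumDir (v : Fin p → ℝ) (n : ℕ) :
    ∫ x, Real.exp (sumDir μ v n x) ∂(lawChange μ 1) = Real.exp (n * (∑ k, v k ^ 2) / 2) := by
  induction n with
  | zero => simp [sumDir]
  | succ n ih =>
    have hm : Measurable[info p n] fun x => Real.exp (sumDir μ v n x) :=
      Real.measurable_exp.comp (measurable_sumDir_info μ v n)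
    have h := integral_past_mul_noise μ n hm
      (H := fun y => Real.exp (∑ k, v k * (y k - μ k))) (by fun_prop)
    rw [integral_obsLaw_exp, ih, ← Real.exp_add] at h
    have e : ∀ x, Real.exp (sumDir μ v (n + 1) x)
        = Real.exp (sumDir μ v n x) * Real.exp (∑ k, v k * (x (n + 1) k - μ k)) := by
      intro x
      rw [← Real.exp_add]
      unfold sumDir
      rw [Finset.sum_Icc_succ_top (by omega)]
      rfl
    simp_rw [e]
    rw [h]
    congr 1
    push_cast
    ring

theorem integrable_exp_sumDir (v : Fin p → ℝ) (n : ℕ) :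
    Integrable (fun x => Real.exp (sumDir μ v n x)) (lawChange μ 1) := by
  refine Integrable.of_integral_ne_zero ?_
  rw [integral_exp_sumDir]
  exact (Real.exp_pos _).ne'

theorem sumDir_smul (v : Fin p → ℝ) (s : ℝ) (n : ℕ) (x : Obs p) :
    sumDir μ (fun k => s * v k) n x = s * sumDir μ v n x := by
  unfold sumDir noiseDir
  rw [Finset.mul_sum]
  refine Finset.sum_congr rfl fun i _ => ?_
  rw [Finset.mul_sum]
  exact Finset.sum_congr rfl fun k _ => by ring

/-- A Chernoff bound for an excess: `y ≤ exp (s y) / s` with `y = |S| - d`, and `exp (s |S|) ≤ exp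
(s S) + exp (-s S)`. -/
theorem integral_max_abs_sumDir_sub_le (v : Fin p → ℝ) (n : ℕ) (d : ℝ) {s : ℝ} (hs : 0 < s) :
    ∫ x, max (|sumDir μ v n x| - d) 0 ∂(lawChange μ 1)
      ≤ 2 / s * Real.exp (-(s * d) + s ^ 2 * (n * ∑ k, v k ^ 2) / 2) := by
  have hE : ∀ r : ℝ, Integrable (fun x => Real.exp (r * sumDir μ v n x)) (lawChange μ 1) ∧
      ∫ x, Real.exp (r * sumDir μ v n x) ∂(lawChange μ 1)
        = Real.exp (r ^ 2 * (n * ∑ k, v k ^ 2) / 2) := by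
    intro r
    have h1 := integrable_exp_sumDir μ (fun k => r * v k) n
    have h2 := integral_exp_sumDir μ (fun k => r * v k) n
    simp_rw [sumDir_smul] at h1 h2
    refine ⟨h1, h2.trans ?_⟩
    simp_rw [mul_pow]
    rw [← Finset.mul_sum]
    congr 1
    ring
  obtain ⟨i1, e1⟩ := hE s
  obtain ⟨i2, e2⟩ := hE (-s)
  have h := integral_mono
    ((hasMoments_sumDir μ v n).abs.sub (HasMoments.const d)).max_zero.integrable
    ((i1.add i2).const_mul (Real.exp (-(s * d)) / s)) fun x => by
      set t := sumDir μ v n x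
      have hpos : 0 ≤ Real.exp (-(s * d)) / s * (Real.exp (s * t) + Real.exp (-s * t)) := by
        positivity
      refine max_le ?_ hpos
      have h1 : s * (|t| - d) ≤ Real.exp (s * (|t| - d)) := by
        linarith [Real.add_one_le_exp (s * (|t| - d))]
      have h2 : Real.exp (s * |t|) ≤ Real.exp (s * t) + Real.exp (-s * t) := by
        rcases abs_choice t with h | h <;> rw [h]
        · linarith [Real.exp_pos (-s * t)]
        · rw [show s * -t = -s * t by ring]
          linarith [Real.exp_pos (s * t)]
      have h3 : Real.exp (s * (|t| - d)) = Real.exp (-(s * d)) * Real.exp (s * |t|) := by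
        rw [← Real.exp_add]; congr 1; ring
      rw [h3] at h1
      have h4 := mul_le_mul_of_nonneg_left h2 (Real.exp_pos (-(s * d))).le
      have h5 : Real.exp (-(s * d)) / s * (Real.exp (s * t) + Real.exp (-s * t))
          = Real.exp (-(s * d)) * (Real.exp (s * t) + Real.exp (-s * t)) / s := by ring
      change |t| - d ≤ Real.exp (-(s * d)) / s * (Real.exp (s * t) + Real.exp (-s * t))
      rw [h5, le_div_iff₀ hs]
      linarith
  rw [integral_const_mul, integral_add' i1 i2, e1, e2, neg_sq] at h
  refine h.trans (le_of_eq ?_)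
  rw [Real.exp_add]
  ring

/-- The interaction of the average noise with the next noise. -/
noncomputable def avgNoiseNext (n : ℕ) (x : Obs p) : ℝ :=
  ∑ k, avgNoise μ n k x * noise μ (n + 1) k x

theorem avgNext_eq (n : ℕ) (x : Obs p) :
    avgNext c ω μ n x = avgDir μ (gap c ω μ) n x + avgNoiseNext μ n x := by
  unfold avgNext avgDir avgNoiseNext
  rw [← Finset.sum_add_distrib]
  exact Finset.sum_congr rfl fun k _ => by ring

theorem hasMoments_avgNoiseNext (n : ℕ) : HasMoments (lawChange μ 1) (avgNoiseNext μ n) :=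
  HasMoments.sum _ fun k _ => (hasMoments_avgNoise μ n k).mul
    (hasMoments_noise μ (Nat.le_add_left 1 n) k)

theorem integral_avgNoiseNext_sq_le {n : ℕ} (hn : 1 ≤ n) :
    ∫ x, avgNoiseNext μ n x ^ 2 ∂(lawChange μ 1) ≤ p ^ 2 * (1 / (n : ℝ)) := by
  have hε := fun k => hasMoments_noise μ (Nat.le_add_left 1 n) k
  have hk : ∀ k, HasMoments (lawChange μ 1) fun x => avgSq μ n x * noise μ (n + 1) k x ^ 2 :=
    fun k => (hasMoments_avgSq μ n).mul ((hε k).pow 2)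
  have h := integral_mono ((hasMoments_avgNoiseNext μ n).pow 2).integrable
    (HasMoments.sum Finset.univ fun k _ => hk k).integrable fun x => by
      rw [← Finset.mul_sum]
      exact Finset.sum_mul_sq_le_sq_mul_sq _ _ _
  rw [integral_finsetSum _ fun k _ => (hk k).integrable] at h
  simp_rw [fun k => integral_past_mul_noise_sq μ n (measurable_avgSq_info μ (le_refl n)) k,
    integral_avgSq μ hn] at h
  refine h.trans (le_of_eq ?_)
  simp
  ring

theorem integral_past_mul_avgNoiseNext (n : ℕ) {G : Obs p → ℝ} (hG : HasMoments (lawChange μ 1) G)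
    (hm : Measurable[info p n] G) : ∫ x, G x * avgNoiseNext μ n x ∂(lawChange μ 1) = 0 := by
  have hk : ∀ k, HasMoments (lawChange μ 1)
      fun x => G x * avgNoise μ n k x * noise μ (n + 1) k x := fun k =>
    (hG.mul (hasMoments_avgNoise μ n k)).mul (hasMoments_noise μ (Nat.le_add_left 1 n) k)
  have e : ∀ x, G x * avgNoiseNext μ n x
      = ∑ k, G x * avgNoise μ n k x * noise μ (n + 1) k x := by
    intro x
    rw [avgNoiseNext, Finset.mul_sum]
    exact Finset.sum_congr rfl fun k _ => by ring
  simp_rw [e]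
  rw [integral_finsetSum _ fun k _ => (hk k).integrable]
  exact Finset.sum_eq_zero fun k _ =>
    integral_past_mul_noise_eq_zero μ n (hm.mul (measurable_avgNoise_info μ le_rfl k)) k

/-- The summands are martingale differences, so the cross terms vanish and the second moments add.
-/
theorem integral_sum_avgNoiseNext_sq_le {n : ℕ} (hn : 1 ≤ n) :
    ∫ x, (∑ j ∈ Finset.Ico 1 n, avgNoiseNext μ j x) ^ 2 ∂(lawChange μ 1)
      ≤ p ^ 2 * ∑ j ∈ Finset.Ico 1 n, 1 / (j : ℝ) := by
  induction n, hn using Nat.le_induction with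
  | base => simp
  | succ n hn ih =>
    have hX : HasMoments (lawChange μ 1) fun x => ∑ j ∈ Finset.Ico 1 n, avgNoiseNext μ j x :=
      HasMoments.sum _ fun j _ => hasMoments_avgNoiseNext μ j
    have hXm : Measurable[info p n] fun x => ∑ j ∈ Finset.Ico 1 n, avgNoiseNext μ j x :=
      Finset.measurable_sum _ fun j hj => Finset.measurable_sum _ fun k _ =>
        (measurable_avgNoise_info μ (Finset.mem_Ico.1 hj).2.le k).mul
          (measurable_noise_info μ (by omega) (by have := (Finset.mem_Ico.1 hj).2; omega) k)
    have hZ := hasMoments_avgNoiseNext μ n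
    simp_rw [Finset.sum_Ico_succ_top hn]
    set X : Obs p → ℝ := fun x => ∑ j ∈ Finset.Ico 1 n, avgNoiseNext μ j x with hXd
    have e : ∀ x, (X x + avgNoiseNext μ n x) ^ 2
        = X x ^ 2 + 2 * (X x * avgNoiseNext μ n x) + avgNoiseNext μ n x ^ 2 := by
      intro x; ring
    change ∫ x, (X x + avgNoiseNext μ n x) ^ 2 ∂_ ≤ _
    simp_rw [e]
    have i1 := hX.pow 2
    have i2 := (hX.mul hZ).const_mul 2
    rw [integral_add (i1.add i2).integrable (hZ.pow 2).integrable,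
      integral_add i1.integrable i2.integrable, integral_const_mul,
      integral_past_mul_avgNoiseNext μ n hX hXm, mul_add]
    have := integral_avgNoiseNext_sq_le μ hn
    linarith

/-- Cauchy–Schwarz with weights `1 / j` against `j avgSq²`, whose means are again of order `1 / j`.
-/
theorem integral_sum_avgSq_sq_le : ∃ C : ℝ, 0 ≤ C ∧ ∀ n : ℕ,
    ∫ x, (∑ j ∈ Finset.Ico 1 n, avgSq μ j x) ^ 2 ∂(lawChange μ 1)
      ≤ C * (∑ j ∈ Finset.Ico 1 n, 1 / (j : ℝ)) ^ 2 := by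
  obtain ⟨C, hC0, hC⟩ := integral_avgSq_sq_le μ
  refine ⟨C, hC0, fun n => ?_⟩
  set H := ∑ j ∈ Finset.Ico 1 n, 1 / (j : ℝ) with hH
  have hH0 : 0 ≤ H := Finset.sum_nonneg fun j _ => by positivity
  have hk : ∀ j : ℕ, HasMoments (lawChange μ 1) fun x => H * (j * avgSq μ j x ^ 2) :=
    fun j => (((hasMoments_avgSq μ j).pow 2).const_mul (j : ℝ)).const_mul H
  have h := integral_mono
    ((HasMoments.sum (Finset.Ico 1 n) fun j _ => hasMoments_avgSq μ j).pow 2).integrable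
    (HasMoments.sum (Finset.Ico 1 n) fun j _ => hk j).integrable fun x => by
      rw [← Finset.mul_sum]
      refine Finset.sum_sq_le_sum_mul_sum_of_sq_le_mul _ (fun j _ => by positivity)
        (fun j _ => by positivity) fun j hj => ?_
      have hj0 : (j : ℝ) ≠ 0 := by
        have := (Finset.mem_Ico.1 hj).1
        positivity
      exact le_of_eq (by field_simp)
  rw [integral_finsetSum _ fun j _ => (hk j).integrable] at h
  refine h.trans ?_
  have h2 : ∀ j ∈ Finset.Ico 1 n, ∫ x, H * (j * avgSq μ j x ^ 2) ∂(lawChange μ 1)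
      ≤ H * C * (1 / (j : ℝ)) := by
    intro j hj
    have hj1 := (Finset.mem_Ico.1 hj).1
    have hj0 : (0 : ℝ) < j := by positivity
    rw [integral_const_mul, integral_const_mul, mul_assoc]
    refine mul_le_mul_of_nonneg_left ?_ hH0
    calc (j : ℝ) * ∫ x, avgSq μ j x ^ 2 ∂(lawChange μ 1) ≤ j * (C / j ^ 2) :=
          mul_le_mul_of_nonneg_left (hC j hj1) hj0.le
      _ = _ := by field_simp
  refine (Finset.sum_le_sum h2).trans (le_of_eq ?_)
  rw [← Finset.mul_sum, ← hH]
  ring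

theorem sum_Ico_inv_sqrt_le (n : ℕ) : ∑ j ∈ Finset.Ico 1 n, 1 / √(j : ℝ) ≤ 2 * √(n : ℝ) := by
  have h : ∑ j ∈ Finset.Ico 1 (n + 1), 1 / √(j : ℝ) ≤ 2 * √(n : ℝ) := by
    induction n with
    | zero => simp
    | succ n ih =>
      rw [Finset.sum_Ico_succ_top (by omega)]
      have h1 : 0 < √((n + 1 : ℕ) : ℝ) := Real.sqrt_pos.2 (by positivity)
      have h2 : √(n : ℝ) * √(n : ℝ) = n := Real.mul_self_sqrt n.cast_nonneg
      have h3 : √((n + 1 : ℕ) : ℝ) * √((n + 1 : ℕ) : ℝ) = n + 1 := by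
        rw [Real.mul_self_sqrt (by positivity)]; push_cast; ring
      have h4 : 1 / √((n + 1 : ℕ) : ℝ) ≤ 2 * √((n + 1 : ℕ) : ℝ) - 2 * √(n : ℝ) := by
        rw [div_le_iff₀ h1]
        nlinarith [sq_nonneg (√((n + 1 : ℕ) : ℝ) - √(n : ℝ))]
      linarith
  refine (Finset.sum_le_sum_of_subset_of_nonneg ?_ fun j _ _ => by positivity).trans h
  exact Finset.Ico_subset_Ico_right n.le_succ

/-- The part of the log likelihood ratio that is not linear in the noise up to time `n`. -/
noncomputable def quadPart (n : ℕ) (x : Obs p) : ℝ :=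
  -noiseDir μ (muStar c ω μ) 1 x + c * ∑ j ∈ Finset.Ico 1 n, avgNoiseNext μ j x
    - c ^ 2 / 2 * ∑ j ∈ Finset.Ico 1 n, avgSq μ j x

theorem hasMoments_quadPart (n : ℕ) : HasMoments (lawChange μ 1) (quadPart c ω μ n) :=
  ((hasMoments_noiseDir μ _ le_rfl).neg.add ((HasMoments.sum _ fun j _ =>
    hasMoments_avgNoiseNext μ j).const_mul c)).sub
    ((HasMoments.sum _ fun j _ => hasMoments_avgSq μ j).const_mul _)

theorem logLR_eq {n : ℕ} (hn : 1 ≤ n) (x : Obs p) :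
    logLR c ω μ n x = infoStar c ω μ * (n - 1) + (sumDir μ (muStar c ω μ) n x
      + ∑ j ∈ Finset.Ico 1 n, c * avgDir μ (gap c ω μ) j x + quadPart c ω μ n x) := by
  induction n, hn using Nat.le_induction with
  | base => simp [logLR, sumDir, quadPart]
  | succ n hn ih =>
    unfold logLR sumDir quadPart at ih ⊢
    rw [Finset.sum_Ico_succ_top hn, Finset.sum_Icc_succ_top (by omega), Finset.sum_Ico_succ_top hn,
      Finset.sum_Ico_succ_top hn, Finset.sum_Ico_succ_top hn, ih, llrIncr_eq, avgNext_eq]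
    push_cast
    ring

theorem integral_quadPart_sq_le : ∃ C : ℝ, 0 ≤ C ∧ ∀ n : ℕ, 1 ≤ n →
    ∫ x, quadPart c ω μ n x ^ 2 ∂(lawChange μ 1) ≤ C * (1 + Real.log n) ^ 2 := by
  obtain ⟨C, hC0, hC⟩ := integral_sum_avgSq_sq_le μ
  have i1 := (hasMoments_noiseDir μ (muStar c ω μ) le_rfl).pow 2
  set V := ∫ x, noiseDir μ (muStar c ω μ) 1 x ^ 2 ∂(lawChange μ 1) with hV
  have hV0 : 0 ≤ V := integral_nonneg fun x => sq_nonneg _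
  refine ⟨3 * V + 3 * c ^ 2 * p ^ 2 + 3 * (c ^ 2 / 2) ^ 2 * C, by positivity, fun n hn => ?_⟩
  have i2 := (HasMoments.sum (Finset.Ico 1 n) fun j _ => hasMoments_avgNoiseNext μ j).pow 2
  have i3 := (HasMoments.sum (Finset.Ico 1 n) fun j _ => hasMoments_avgSq μ j).pow 2
  have j1 := i1.const_mul 3
  have j2 := i2.const_mul (3 * c ^ 2)
  have j3 := i3.const_mul (3 * (c ^ 2 / 2) ^ 2)
  have h := integral_mono ((hasMoments_quadPart c ω μ n).pow 2).integrable
    ((j1.add j2).add j3).integrable fun x => by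
      unfold quadPart
      set s := noiseDir μ (muStar c ω μ) 1 x
      set t := ∑ j ∈ Finset.Ico 1 n, avgNoiseNext μ j x
      set r := ∑ j ∈ Finset.Ico 1 n, avgSq μ j x
      change (-s + c * t - c ^ 2 / 2 * r) ^ 2
        ≤ 3 * s ^ 2 + 3 * c ^ 2 * t ^ 2 + 3 * (c ^ 2 / 2) ^ 2 * r ^ 2
      nlinarith [sq_nonneg (-s - c * t), sq_nonneg (-s + c ^ 2 / 2 * r),
        sq_nonneg (c * t + c ^ 2 / 2 * r)]
  rw [integral_add (j1.add j2).integrable j3.integrable,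
    integral_add j1.integrable j2.integrable, integral_const_mul, integral_const_mul,
    integral_const_mul] at h
  have h1 := sum_Ico_inv_le hn
  have h2 := integral_sum_avgNoiseNext_sq_le μ hn
  have h3 := hC n
  set H := ∑ j ∈ Finset.Ico 1 n, 1 / (j : ℝ) with hH
  have hH0 : 0 ≤ H := Finset.sum_nonneg fun j _ => by positivity
  have hl : 0 ≤ Real.log n := Real.log_natCast_nonneg n
  set Λ := 1 + Real.log n with hΛ
  have hΛ1 : 1 ≤ Λ := by linarith
  have h4 : H ^ 2 ≤ Λ ^ 2 := pow_le_pow_left₀ hH0 h1 2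
  have h5 : H ≤ Λ ^ 2 := by nlinarith
  have h6 : V ≤ V * Λ ^ 2 := le_mul_of_one_le_right hV0 (by nlinarith)
  have h7 : 3 * c ^ 2 * ∫ x, (∑ j ∈ Finset.Ico 1 n, avgNoiseNext μ j x) ^ 2 ∂(lawChange μ 1)
      ≤ 3 * c ^ 2 * p ^ 2 * Λ ^ 2 := by
    rw [mul_assoc (3 * c ^ 2)]
    refine mul_le_mul_of_nonneg_left (h2.trans ?_) (by positivity)
    exact mul_le_mul_of_nonneg_left h5 (by positivity)
  have h8 : 3 * (c ^ 2 / 2) ^ 2 * ∫ x, (∑ j ∈ Finset.Ico 1 n, avgSq μ j x) ^ 2 ∂(lawChange μ 1)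
      ≤ 3 * (c ^ 2 / 2) ^ 2 * C * Λ ^ 2 := by
    rw [mul_assoc (3 * (c ^ 2 / 2) ^ 2)]
    refine mul_le_mul_of_nonneg_left (h3.trans ?_) (by positivity)
    exact mul_le_mul_of_nonneg_left h4 hC0
  linarith

/-- The log likelihood ratio deviates from its drift by little more than the square root of time. -/
theorem integral_max_abs_logLR_sub_le (hc0 : 0 ≤ c) (hc1 : c ≤ 1) :
    ∃ C G : ℝ, 0 ≤ C ∧ 0 ≤ G ∧ ∀ (n : ℕ) (q D s : ℝ), 1 ≤ n → √n ≤ q → 0 < D → 0 < s →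
      ∫ x, max (|logLR c ω μ n x - infoStar c ω μ * (n - 1)| - D) 0 ∂(lawChange μ 1)
        ≤ 6 * q / s * Real.exp (-(s * D / (6 * q)) + s ^ 2 * G / 2)
          + C * (1 + Real.log n) ^ 2 / D := by
  obtain ⟨C, hC0, hC⟩ := integral_quadPart_sq_le c ω μ
  set G₁ := ∑ k, muStar c ω μ k ^ 2 with hG₁
  set G₂ := ∑ k, gap c ω μ k ^ 2 with hG₂
  have hG₁0 : 0 ≤ G₁ := Finset.sum_nonneg fun _ _ => sq_nonneg _
  have hG₂0 : 0 ≤ G₂ := Finset.sum_nonneg fun _ _ => sq_nonneg _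
  refine ⟨3 * C, G₁ + G₂, by positivity, by positivity, fun n q D s hn hq hD hs => ?_⟩
  have hn0 : (0 : ℝ) < n := by exact_mod_cast hn
  have hq0 : 0 < q := (Real.sqrt_pos.2 hn0).trans_le hq
  have hnq : (n : ℝ) ≤ q ^ 2 := by
    rw [← Real.sq_sqrt hn0.le]
    exact pow_le_pow_left₀ (Real.sqrt_nonneg _) hq 2
  set X := Real.exp (-(s * D / (6 * q)) + s ^ 2 * (G₁ + G₂) / 2) with hX
  -- A third of `D` is shared among the linear errors in proportion to their standard deviations `1
  -- / √j`. Since `∑ 1 / √j ≤ 2 √n ≤ 2 q`, the shares add up to at most `D / 3`.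
  set d : ℕ → ℝ := fun j => D / (6 * q) * (1 / √(j : ℝ)) with hd
  have i1 := ((hasMoments_sumDir μ (muStar c ω μ) n).abs.sub (HasMoments.const (D / 3))).max_zero
  have i2 : ∀ j, HasMoments (lawChange μ 1)
      fun x => max (|avgDir μ (gap c ω μ) j x| - d j) 0 := fun j =>
    ((hasMoments_avgDir μ (gap c ω μ) j).abs.sub (HasMoments.const (d j))).max_zero
  have i3 := ((hasMoments_quadPart c ω μ n).pow 2).const_mul (3 / D)
  have i2s := HasMoments.sum (Finset.Ico 1 n) fun j _ => i2 j
  have hdsum : ∑ j ∈ Finset.Ico 1 n, d j ≤ D / 3 := by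
    rw [hd, ← Finset.mul_sum]
    have h1 := (sum_Ico_inv_sqrt_le n).trans (mul_le_mul_of_nonneg_left hq zero_le_two)
    calc _ ≤ D / (6 * q) * (2 * q) := mul_le_mul_of_nonneg_left h1 (by positivity)
      _ = D / 3 := by field_simp; norm_num
  have h := integral_mono (((hasMoments_logLR c ω μ n).sub (HasMoments.const
      (infoStar c ω μ * (n - 1)))).abs.sub (HasMoments.const D)).max_zero.integrable
    ((i1.add i2s).add i3).integrable fun x => by
      change max (|logLR c ω μ n x - infoStar c ω μ * (n - 1)| - D) 0
        ≤ max (|sumDir μ (muStar c ω μ) n x| - D / 3) 0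
          + ∑ j ∈ Finset.Ico 1 n, max (|avgDir μ (gap c ω μ) j x| - d j) 0
          + 3 / D * quadPart c ω μ n x ^ 2
      rw [logLR_eq c ω μ hn, add_sub_cancel_left]
      set t := sumDir μ (muStar c ω μ) n x
      set r := quadPart c ω μ n x
      have h2 : |∑ j ∈ Finset.Ico 1 n, c * avgDir μ (gap c ω μ) j x| - D / 3
          ≤ ∑ j ∈ Finset.Ico 1 n, max (|avgDir μ (gap c ω μ) j x| - d j) 0 := by
        have h3 : |∑ j ∈ Finset.Ico 1 n, c * avgDir μ (gap c ω μ) j x|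
            ≤ ∑ j ∈ Finset.Ico 1 n, |avgDir μ (gap c ω μ) j x| := by
          refine (Finset.abs_sum_le_sum_abs _ _).trans (Finset.sum_le_sum fun j _ => ?_)
          rw [abs_mul, abs_of_nonneg hc0]
          exact mul_le_of_le_one_left (abs_nonneg _) hc1
        have h4 : ∑ j ∈ Finset.Ico 1 n, |avgDir μ (gap c ω μ) j x| - ∑ j ∈ Finset.Ico 1 n, d j
            ≤ ∑ j ∈ Finset.Ico 1 n, max (|avgDir μ (gap c ω μ) j x| - d j) 0 := by
          rw [← Finset.sum_sub_distrib]
          exact Finset.sum_le_sum fun j _ => le_max_left _ _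
        linarith
      have h2' : 0 ≤ ∑ j ∈ Finset.Ico 1 n, max (|avgDir μ (gap c ω μ) j x| - d j) 0 :=
        Finset.sum_nonneg fun j _ => le_max_right _ _
      have h3 : |r| - D / 3 ≤ 3 / D * r ^ 2 := by
        rw [← sq_abs r, div_mul_eq_mul_div, le_div_iff₀ hD]
        nlinarith [sq_nonneg (2 * |r| - D / 2), sq_nonneg (|r|), sq_nonneg D]
      have h3' : 0 ≤ 3 / D * r ^ 2 := by positivity
      refine max_le ?_ (by linarith [le_max_right (|t| - D / 3) 0])
      have h4 := abs_add_three t (∑ j ∈ Finset.Ico 1 n, c * avgDir μ (gap c ω μ) j x) r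
      linarith [le_max_left (|t| - D / 3) 0]
  rw [integral_add (i1.add i2s).integrable i3.integrable,
    integral_add i1.integrable i2s.integrable, integral_const_mul,
    integral_finsetSum _ fun j _ => (i2 j).integrable] at h
  have b1 : ∫ x, max (|sumDir μ (muStar c ω μ) n x| - D / 3) 0 ∂(lawChange μ 1)
      ≤ 2 * q / s * X := by
    refine (integral_max_abs_sumDir_sub_le μ _ n (D / 3)
      (s := s / q) (by positivity)).trans ?_
    have e1 : 2 / (s / q) = 2 * q / s := by field_simp
    rw [e1]
    refine mul_le_mul_of_nonneg_left (Real.exp_le_exp.2 ?_) (by positivity)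
    have e2 : s * D / (6 * q) ≤ s / q * (D / 3) := by
      rw [div_mul_div_comm]
      exact div_le_div_of_nonneg_left (by positivity) (by positivity) (by linarith)
    have e3 : (s / q) ^ 2 * (n * G₁) ≤ s ^ 2 * (G₁ + G₂) := by
      rw [div_pow, div_mul_eq_mul_div, div_le_iff₀ (by positivity), mul_assoc]
      refine mul_le_mul_of_nonneg_left ?_ (by positivity)
      nlinarith [mul_nonneg hG₂0 (sq_nonneg q)]
    linarith
  have b2 : ∀ j ∈ Finset.Ico 1 n,
      ∫ x, max (|avgDir μ (gap c ω μ) j x| - d j) 0 ∂(lawChange μ 1)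
        ≤ 2 / s * X * (1 / √(j : ℝ)) := by
    intro j hj
    have hj0 : (0 : ℝ) < j := by exact_mod_cast (Finset.mem_Ico.1 hj).1
    have hs0 : 0 < √(j : ℝ) := Real.sqrt_pos.2 hj0
    have hss : √(j : ℝ) * √(j : ℝ) = j := Real.mul_self_sqrt hj0.le
    have e : ∀ x, max (|avgDir μ (gap c ω μ) j x| - d j) 0
        = 1 / (j : ℝ) * max (|sumDir μ (gap c ω μ) j x| - j * d j) 0 := by
      intro x
      rw [avgDir_eq_sumDir_div, abs_div, abs_of_pos hj0, mul_max_of_nonneg _ _ (by positivity)]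
      congr 1
      · field_simp
      · simp
    simp_rw [e]
    rw [integral_const_mul]
    -- Scaling the exponent by `1 / √j` makes the exponential factor the same for every `j`.
    have h5 := integral_max_abs_sumDir_sub_le μ (gap c ω μ) j (j * d j)
      (s := s / √(j : ℝ)) (by positivity)
    have h6 : Real.exp (-(s / √(j : ℝ) * (j * d j))
        + (s / √(j : ℝ)) ^ 2 * (j * ∑ k, gap c ω μ k ^ 2) / 2) ≤ X := by
      refine Real.exp_le_exp.2 ?_
      have e2 : s / √(j : ℝ) * (j * d j) = s * D / (6 * q) := by
        simp only [hd]
        field_simp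
        rw [Real.sq_sqrt hj0.le]
      have e3 : (s / √(j : ℝ)) ^ 2 * (j * ∑ k, gap c ω μ k ^ 2) = s ^ 2 * G₂ := by
        rw [div_pow, Real.sq_sqrt hj0.le, ← hG₂]
        field_simp
      rw [e2, e3]
      nlinarith [mul_nonneg hG₁0 (sq_nonneg s)]
    calc _ ≤ 1 / (j : ℝ) * (2 / (s / √(j : ℝ)) * X) :=
          mul_le_mul_of_nonneg_left (h5.trans (mul_le_mul_of_nonneg_left h6 (by positivity)))
            (by positivity)
      _ = 2 / s * X * (1 / √(j : ℝ)) := by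
          nth_rewrite 1 [← hss]
          field_simp
  have b2' := Finset.sum_le_sum b2
  rw [← Finset.mul_sum] at b2'
  have b2'' : 2 / s * X * ∑ j ∈ Finset.Ico 1 n, 1 / √(j : ℝ) ≤ 4 * q / s * X := by
    have h1 := (sum_Ico_inv_sqrt_le n).trans (mul_le_mul_of_nonneg_left hq zero_le_two)
    calc _ ≤ 2 / s * X * (2 * q) :=
          mul_le_mul_of_nonneg_left h1 (mul_nonneg (by positivity) (Real.exp_pos _).le)
      _ = _ := by ring
  have b3 : 3 / D * ∫ x, quadPart c ω μ n x ^ 2 ∂(lawChange μ 1)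
      ≤ 3 * C * (1 + Real.log n) ^ 2 / D := by
    calc _ ≤ 3 / D * (C * (1 + Real.log n) ^ 2) :=
          mul_le_mul_of_nonneg_left (hC n hn) (by positivity)
      _ = _ := by ring
  have e : 6 * q / s * X = 2 * q / s * X + 4 * q / s * X := by ring
  rw [e]
  linarith

end SRRS

/-! ### The sharp passage time estimate and the delay bound -/

namespace SRRS

variable {p : ℕ} (c : ℝ) (ω μ : Fin p → ℝ)

/-- The log likelihood ratio is concentrated on the scale `√n log n`. -/
theorem integral_max_abs_logLR_sub_sqrt_mul_log_le (hc0 : 0 ≤ c) (hc1 : c ≤ 1) {δ : ℝ}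
    (hδ : 0 < δ) : ∃ C : ℝ, 0 ≤ C ∧ ∀ n₀ n : ℕ, 3 ≤ n₀ → 1 ≤ n → n ≤ 2 * n₀ →
      ∫ x, max (|logLR c ω μ n x - infoStar c ω μ * (n - 1)| - δ * (√n₀ * Real.log n₀)) 0
        ∂(lawChange μ 1) ≤ C := by
  obtain ⟨C, G, hC0, hG0, h⟩ := integral_max_abs_logLR_sub_le c ω μ hc0 hc1
  -- Makes the exponent equal to `-log n₀`, so that the factor `1 / n₀` beats the prefactor of order
  -- `√n₀`.
  set s := 12 / δ with hs
  refine ⟨δ * Real.exp (s ^ 2 * G / 2) + 18 * C / δ, by positivity,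
    fun n₀ n hn₀ hn1 hn2 => ?_⟩
  have hn₀3 : (3 : ℝ) ≤ n₀ := by exact_mod_cast hn₀
  have hn₀0 : (0 : ℝ) < n₀ := by linarith
  have hsq : 0 < √(n₀ : ℝ) := Real.sqrt_pos.2 hn₀0
  have hlog : 1 ≤ Real.log n₀ := by
    rw [Real.le_log_iff_exp_le hn₀0]
    linarith [Real.exp_one_lt_d9]
  have hq : √(n : ℝ) ≤ 2 * √(n₀ : ℝ) := by
    have : (2 : ℝ) = √4 := by
      rw [show (4 : ℝ) = 2 ^ 2 by norm_num, Real.sqrt_sq (by norm_num)]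
    rw [this, ← Real.sqrt_mul (by norm_num)]
    refine Real.sqrt_le_sqrt ?_
    have : (n : ℝ) ≤ 2 * n₀ := by exact_mod_cast hn2
    linarith
  have h1 := h n (2 * √(n₀ : ℝ)) (δ * (√n₀ * Real.log n₀)) s hn1 hq (by positivity)
    (by positivity)
  refine h1.trans (add_le_add ?_ ?_)
  · have e1 : s * (δ * (√(n₀ : ℝ) * Real.log n₀)) / (6 * (2 * √(n₀ : ℝ))) = Real.log n₀ := by
      rw [hs]; field_simp; norm_num
    have e2 : 6 * (2 * √(n₀ : ℝ)) / s = δ * √(n₀ : ℝ) := by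
      rw [hs]; field_simp; norm_num
    rw [e1, e2, Real.exp_add, Real.exp_neg, Real.exp_log hn₀0, mul_assoc]
    refine mul_le_mul_of_nonneg_left ?_ hδ.le
    rw [← mul_assoc]
    refine mul_le_of_le_one_left (Real.exp_pos _).le ?_
    rw [← div_eq_mul_inv, div_le_one hn₀0]
    calc √(n₀ : ℝ) ≤ √(n₀ : ℝ) * √(n₀ : ℝ) :=
          le_mul_of_one_le_right hsq.le (Real.one_le_sqrt.2 (by linarith))
      _ = n₀ := Real.mul_self_sqrt hn₀0.le
  · have hlogn : Real.log n ≤ 2 * Real.log n₀ := by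
      rw [← Real.log_rpow hn₀0]
      refine Real.log_le_log (by exact_mod_cast hn1) ?_
      have : (n : ℝ) ≤ 2 * n₀ := by exact_mod_cast hn2
      norm_num
      nlinarith
    have hlogn0 : 0 ≤ Real.log n := Real.log_natCast_nonneg n
    have h2 : (1 + Real.log n) ^ 2 ≤ 9 * Real.log n₀ ^ 2 := by nlinarith
    have h3 : Real.log n₀ ≤ 2 * √(n₀ : ℝ) := by
      have h4 := Real.log_le_sub_one_of_pos hsq
      rw [Real.log_sqrt hn₀0.le] at h4
      linarith
    rw [div_le_div_iff₀ (by positivity) hδ]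
    calc C * (1 + Real.log n) ^ 2 * δ ≤ C * (9 * Real.log n₀ ^ 2) * δ := by gcongr
      _ = 9 * C * δ * Real.log n₀ * Real.log n₀ := by ring
      _ ≤ 9 * C * δ * Real.log n₀ * (2 * √(n₀ : ℝ)) := by gcongr
      _ = _ := by ring

theorem meanSurvival_mono (b : ℝ) (m : ℕ) {N N' : ℕ} (h : N ≤ N') :
    meanSurvival c ω μ b m N ≤ meanSurvival c ω μ b m N' :=
  Finset.sum_le_sum_of_subset_of_nonneg (Finset.Ico_subset_Ico_right h)
    fun _ _ _ => measureReal_nonneg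

/-- Being above `b` at time `n` requires a deviation larger than `D`. Hence the positive part
differs from `b - L_n` by at most the excess deviation, and the exact mean of `L_n` enters with its
logarithm. -/
theorem integral_max_sub_logLR_le (hI : 0 ≤ infoStar c ω μ) {n : ℕ} (hn : 1 ≤ n) {b D : ℝ}
    (hD : infoStar c ω μ * n + D ≤ b) :
    ∫ x, max (b - logLR c ω μ n x) 0 ∂(lawChange μ 1)
      ≤ b - infoStar c ω μ * (n - 1) + p * c ^ 2 / 2 * (1 + Real.log n)
        + ∫ x, max (|logLR c ω μ n x - infoStar c ω μ * (n - 1)| - D) 0 ∂(lawChange μ 1) := by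
  have hL := hasMoments_logLR c ω μ n
  have hT := ((hL.sub (HasMoments.const (infoStar c ω μ * (n - 1)))).abs.sub
    (HasMoments.const D)).max_zero
  have i1 := (HasMoments.const (P := lawChange μ 1) b).sub hL
  have h1 := integral_mono i1.max_zero.integrable (i1.add hT).integrable fun x => by
    have h2 := le_max_right (|logLR c ω μ n x - infoStar c ω μ * (n - 1)| - D) 0
    have h3 := le_max_left (|logLR c ω μ n x - infoStar c ω μ * (n - 1)| - D) 0
    have h4 := le_abs_self (logLR c ω μ n x - infoStar c ω μ * (n - 1))
    exact max_le (by linarith) (by linarith)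
  rw [integral_add i1.integrable hT.integrable,
    integral_sub (integrable_const b) hL.integrable, integral_logLR c ω μ hn] at h1
  simp only [integral_const, probReal_univ, one_smul] at h1
  have h6 := mul_le_mul_of_nonneg_left (sum_Ico_inv_le hn)
    (show 0 ≤ p * c ^ 2 / 2 by positivity)
  linarith

theorem integral_max_sub_logLR_le_of_le (hI : 0 ≤ infoStar c ω μ) (n : ℕ) {b D : ℝ}
    (hD : b + D ≤ infoStar c ω μ * n + infoStar c ω μ) :
    ∫ x, max (b - logLR c ω μ n x) 0 ∂(lawChange μ 1)
      ≤ (∫ x, max (|logLR c ω μ n x - infoStar c ω μ * (n - 1)| - D) 0 ∂(lawChange μ 1))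
        + 2 * infoStar c ω μ := by
  have hL := hasMoments_logLR c ω μ n
  have hT := ((hL.sub (HasMoments.const (infoStar c ω μ * (n - 1)))).abs.sub
    (HasMoments.const D)).max_zero
  have i1 := (HasMoments.const (P := lawChange μ 1) b).sub hL
  have i2 := HasMoments.const (P := lawChange μ 1) (2 * infoStar c ω μ)
  have h1 := integral_mono i1.max_zero.integrable (hT.add i2).integrable fun x => by
    have h2 := le_max_right (|logLR c ω μ n x - infoStar c ω μ * (n - 1)| - D) 0
    have h3 := le_max_left (|logLR c ω μ n x - infoStar c ω μ * (n - 1)| - D) 0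
    have h4 := neg_abs_le (logLR c ω μ n x - infoStar c ω μ * (n - 1))
    exact max_le (by linarith) (by linarith)
  rw [integral_add hT.integrable i2.integrable] at h1
  simpa only [integral_const, probReal_univ, one_smul] using h1

set_option maxHeartbeats 1000000 in
/-- The mean passage time, up to a given multiple of the logarithm of the threshold. -/
theorem exists_mul_add_meanSurvival_le (hc0 : 0 ≤ c) (hc1 : c ≤ 1) (hI : 0 < infoStar c ω μ)
    {η : ℝ} (hη : 0 < η) : ∃ (C : ℝ) (k : ℕ), ∀ n₀ : ℕ, k ≤ n₀ → ∀ b : ℝ,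
      infoStar c ω μ * n₀ ≤ b → b ≤ infoStar c ω μ * (n₀ + 1) →
      ∃ n₁ : ℕ, 1 ≤ n₁ ∧ ∀ N : ℕ, n₁ ≤ N →
        infoStar c ω μ * (n₁ + meanSurvival c ω μ b n₁ N)
          ≤ b + (p * c ^ 2 / 2 + η) * Real.log n₀ + C := by
  obtain ⟨C₄, hC₄, hsq⟩ := meanSqError_le c ω μ
  obtain ⟨C₅, m₀, hC₅, hm₀, hcrude⟩ := meanSurvival_le c ω μ hc0 hI
  set I := infoStar c ω μ with hId
  set G := ∑ k, gap c ω μ k ^ 2 with hG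
  have hG0 : 0 ≤ G := Finset.sum_nonneg fun _ _ => sq_nonneg _
  set κ := G * p + 1 with hκ
  have hκ0 : 0 < κ := by positivity
  -- The window then contributes at most `(η / 2) log n₀` plus a constant through the linear errors;
  -- the overshoot uses the other half of `η`.
  set δ := η / (8 * (c * κ + 1)) with hδ
  have hδ0 : 0 < δ := by positivity
  have hδη : c * κ * (4 * δ) ≤ η / 2 := by
    have e : δ * (8 * (c * κ + 1)) = η := by rw [hδ]; field_simp
    nlinarith
  obtain ⟨Ct, hCt, htail⟩ :=
    integral_max_abs_logLR_sub_sqrt_mul_log_le c ω μ hc0 hc1 (mul_pos hI hδ0)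
  rw [← hId] at htail
  set M := Real.exp ((2 / η) ^ 2 * (∑ k, muStar c ω μ k ^ 2) / 2) with hM
  have hM0 : 0 < M := Real.exp_pos _
  have hV := nextSq_nonneg c ω μ
  set V := c ^ 2 * nextSq c ω μ + c ^ 2 / 2 with hVd
  have hV0 : 0 ≤ V := by positivity
  set C₆ := 3 * I + p * c ^ 2 + Ct with hC₆
  have hC₆0 : 0 ≤ C₆ := by positivity
  set C₇ := C₅ * (C₆ + 1) with hC₇
  have hC₇0 : 0 ≤ C₇ := by positivity
  set C₈ := C₅ * (Ct + 2 * I + 1) with hC₈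
  have hC₈0 : 0 ≤ C₈ := by positivity
  have hev : ∀ᶠ x : ℝ in Filter.atTop, Real.log x ≤ 1 / (4 * δ) * √x := by
    have h1 := (isLittleO_log_rpow_atTop (r := 1 / 2) (by norm_num)).bound
      (c := 1 / (4 * δ)) (by positivity)
    filter_upwards [h1, Filter.eventually_ge_atTop 1] with x hx hx1
    rw [Real.norm_eq_abs, Real.norm_eq_abs, abs_of_nonneg (Real.log_nonneg hx1),
      ← Real.sqrt_eq_rpow, abs_of_nonneg (Real.sqrt_nonneg _)] at hx
    exact hx
  obtain ⟨k₁, hk₁⟩ := Filter.eventually_atTop.1 (tendsto_natCast_atTop_atTop.eventually hev)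
  refine ⟨2 * I + p * c ^ 2 / 2 + Ct + 1 + η / 2 * (C₇ * M) + V * (C₄ + C₇) + c * κ * 4
    + (I / 4 * C₈ + c ^ 2 * G / I * (C₄ + C₈)), max k₁ (2 * m₀ + 4), fun n₀ hn₀ b hb1 hb2 => ?_⟩
  have hn₀k : k₁ ≤ n₀ := (le_max_left _ _).trans hn₀
  have hn₀m : 2 * m₀ + 4 ≤ n₀ := (le_max_right _ _).trans hn₀
  have hn₀4 : (4 : ℝ) ≤ n₀ := by exact_mod_cast (show 4 ≤ n₀ by omega)
  have hn₀0 : (0 : ℝ) < n₀ := by linarith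
  have hsq0 : 0 < √(n₀ : ℝ) := Real.sqrt_pos.2 hn₀0
  have hss : √(n₀ : ℝ) * √(n₀ : ℝ) = n₀ := Real.mul_self_sqrt hn₀0.le
  have hlog0 : 0 ≤ Real.log n₀ := Real.log_natCast_nonneg n₀
  set w := ⌈δ * (√(n₀ : ℝ) * Real.log n₀)⌉₊ with hw
  have hw1 : δ * (√(n₀ : ℝ) * Real.log n₀) ≤ w := Nat.le_ceil _
  have hw2 : (w : ℝ) < δ * (√(n₀ : ℝ) * Real.log n₀) + 1 := Nat.ceil_lt_add_one (by positivity)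
  have hw3 : δ * (√(n₀ : ℝ) * Real.log n₀) ≤ n₀ / 4 := by
    have h1 := hk₁ n₀ hn₀k
    calc _ ≤ δ * (√(n₀ : ℝ) * (1 / (4 * δ) * √(n₀ : ℝ))) := by gcongr
      _ = (√(n₀ : ℝ) * √(n₀ : ℝ)) / 4 := by field_simp
      _ = n₀ / 4 := by rw [hss]
  have hw4 : 2 * w ≤ n₀ := by
    have : (2 * w : ℝ) ≤ n₀ := by linarith
    exact_mod_cast this
  obtain ⟨n₁, hn₁⟩ : ∃ n₁, n₀ = n₁ + w := ⟨n₀ - w, by omega⟩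
  set n₂ := n₀ + w with hn₂
  have hn₁1 : 1 ≤ n₁ := by omega
  have hn₁R : (n₀ : ℝ) = n₁ + w := by exact_mod_cast hn₁
  have hn₂R : (n₂ : ℝ) = n₀ + w := by rw [hn₂]; push_cast; ring
  have hn₁0 : (1 : ℝ) ≤ n₁ := by exact_mod_cast hn₁1
  have hn₁h : (n₀ : ℝ) ≤ 2 * n₁ := by exact_mod_cast (show n₀ ≤ 2 * n₁ by omega)
  have hlog1 : Real.log n₁ ≤ Real.log n₀ :=
    Real.log_le_log (by linarith) (by exact_mod_cast (show n₁ ≤ n₀ by omega))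
  refine ⟨n₁, hn₁1, fun N₀ hN₀ => ?_⟩
  -- Splitting the linear errors at `n₂` requires a horizon beyond it; monotonicity brings the
  -- estimate back to `N₀`.
  set N := max N₀ n₂ with hN
  have hN1 : n₁ ≤ N := hN₀.trans (le_max_left _ _)
  have hN2 : n₂ ≤ N := le_max_right _ _
  have ht1 := htail n₀ n₁ (by omega) hn₁1 (by omega)
  have ht2 := htail n₀ n₂ (by omega) (by omega) (by omega)
  set R₁ := ∫ x, max (b - logLR c ω μ n₁ x) 0 ∂(lawChange μ 1) with hR₁
  set R₂ := ∫ x, max (b - logLR c ω μ n₂ x) 0 ∂(lawChange μ 1) with hR₂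
  have hD : I * δ * (√(n₀ : ℝ) * Real.log n₀) ≤ I * w := by
    rw [mul_assoc]
    exact mul_le_mul_of_nonneg_left hw1 hI.le
  have hR₁le : R₁ ≤ b - I * (n₁ - 1) + p * c ^ 2 / 2 * (1 + Real.log n₁) + Ct := by
    have h5 : I * n₀ = I * n₁ + I * w := by rw [hn₁R]; ring
    have h6 := integral_max_sub_logLR_le c ω μ hI.le hn₁1 (b := b) (D := I * δ * (√(n₀ : ℝ)
      * Real.log n₀)) (by linarith)
    rw [← hId] at h6
    exact h6.trans (add_le_add le_rfl ht1)
  have hR₂le : R₂ ≤ Ct + 2 * I := by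
    have h5 : I * n₂ = I * n₀ + I * w := by rw [hn₂R]; ring
    have h6 := integral_max_sub_logLR_le_of_le c ω μ hI.le n₂ (b := b) (D := I * δ * (√(n₀ : ℝ)
      * Real.log n₀)) (by linarith)
    rw [← hId] at h6
    exact h6.trans (add_le_add ht2 le_rfl)
  have hR₁0 : 0 ≤ R₁ := integral_nonneg fun x => le_max_right _ _
  set u := meanSurvival c ω μ b n₁ N with hu
  set u₂ := meanSurvival c ω μ b n₂ N with hu₂
  have hu0 : 0 ≤ u := meanSurvival_nonneg c ω μ b n₁ N
  have hu₂0 : 0 ≤ u₂ := meanSurvival_nonneg c ω μ b n₂ N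
  have hu₂le : u₂ ≤ C₈ := by
    refine (hcrude b n₂ N (by omega) hN2).trans ?_
    exact mul_le_mul_of_nonneg_left (by linarith) hC₅
  -- The crude bound at `n₁` is linear in `n₁`, which is enough for `K = n₁` in the overshoot and
  -- for bounded squared errors.
  have hule : u / n₁ ≤ C₇ := by
    rw [div_le_iff₀ (by linarith)]
    refine (hcrude b n₁ N (by omega) hN1).trans ?_
    rw [hC₇, mul_assoc]
    refine mul_le_mul_of_nonneg_left ?_ hC₅
    have h1 : Real.log n₁ ≤ n₁ - 1 := Real.log_le_sub_one_of_pos (by linarith)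
    have h2 : p * c ^ 2 / 2 * (1 + Real.log n₁) ≤ p * c ^ 2 * n₁ := by
      have : 0 ≤ (p : ℝ) * c ^ 2 := by positivity
      nlinarith
    have h3 : b ≤ I * (2 * n₁ + 1) := hb2.trans (by gcongr)
    have h4 : R₁ ≤ C₆ * n₁ := by
      have h5 : Ct ≤ Ct * n₁ := le_mul_of_one_le_right hCt hn₁0
      have h6 : I ≤ I * n₁ := le_mul_of_one_le_right hI.le hn₁0
      rw [hC₆]
      linarith only [h2, h3, h5, h6, hR₁le]
    have h5 : R₁ + 1 ≤ (C₆ + 1) * n₁ := by linarith only [h4, hn₁0]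
    exact h5
  have hQ₁ := hsq b n₁ N hn₁1 hN1
  have hQ₂ := hsq b n₂ N (by omega) hN2
  have hhalf : u / (2 * n₁) ≤ C₇ := by
    refine le_trans ?_ hule
    exact div_le_div_of_nonneg_left hu0 (by linarith) (by linarith)
  have hhalf₂ : u₂ / (2 * n₂) ≤ C₈ := by
    refine le_trans (div_le_self hu₂0 ?_) hu₂le
    have : (1 : ℝ) ≤ n₂ := by rw [hn₂R]; linarith [w.cast_nonneg (α := ℝ)]
    linarith
  -- With these parameters the overshoot contributes `(η / 2) log n₁` and a bounded term.
  have hW := infoStar_mul_meanSurvival_le c ω μ hc0 hI.le b hn₁1 hN1 (t := 2 / η) (K := n₁)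
    (by positivity) hn₁0
  have hlin := meanLinError_le c ω μ b hn₁1 (show n₁ ≤ n₂ by omega) hN2
  have hlin₂ := mul_meanLinError_le c ω μ b hI n₂ N
  rw [← hId, ← hu, ← hM, ← hR₁] at hW
  rw [← hG, ← hκ] at hlin
  rw [← hId, ← hG, ← hu₂] at hlin₂
  set Q := meanSqError c ω μ b n₁ N
  set Q₂ := meanSqError c ω μ b n₂ N
  have hwin : (n₂ - n₁) * (κ / √(n₁ : ℝ)) ≤ κ * (4 * δ * Real.log n₀ + 4) := by
    have h1 : √(n₀ : ℝ) ≤ 2 * √(n₁ : ℝ) := by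
      have h2 : √(n₀ : ℝ) ≤ √(4 * (n₁ : ℝ)) := Real.sqrt_le_sqrt (by linarith)
      rwa [Real.sqrt_mul (by norm_num), show (4 : ℝ) = 2 ^ 2 by norm_num,
        Real.sqrt_sq (by norm_num)] at h2
    have h2 : 0 < √(n₁ : ℝ) := Real.sqrt_pos.2 (by linarith)
    have h3 : 1 ≤ √(n₀ : ℝ) := Real.one_le_sqrt.2 (by linarith)
    have h4 : (n₂ : ℝ) - n₁ = 2 * w := by linarith
    rw [h4, ← mul_div_assoc, div_le_iff₀ h2]
    have h5 : 2 * (w : ℝ) ≤ (4 * δ * Real.log n₀ + 4) * √(n₁ : ℝ) := by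
      have h6 : 0 ≤ 4 * δ * Real.log n₀ + 4 := by positivity
      have h7 := mul_le_mul_of_nonneg_left h1 h6
      linarith only [h7, hw2, h3]
    calc 2 * (w : ℝ) * κ ≤ (4 * δ * Real.log n₀ + 4) * √(n₁ : ℝ) * κ := by gcongr
      _ = _ := by ring
  have hcl : c * meanLinError c ω μ b n₁ N
      ≤ η / 2 * Real.log n₀ + c * κ * 4 + (I / 4 * C₈ + c ^ 2 * G / I * (C₄ + C₈)) := by
    have h1 := mul_le_mul_of_nonneg_left (hlin.trans (add_le_add hwin le_rfl)) hc0
    have h2 := mul_le_mul_of_nonneg_right hδη hlog0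
    have h3 : I / 4 * u₂ ≤ I / 4 * C₈ := by gcongr
    have h4 : c ^ 2 * G / I * Q₂ ≤ c ^ 2 * G / I * (C₄ + C₈) := by
      gcongr
      linarith only [hQ₂, hhalf₂]
    rw [mul_add, mul_add, mul_add] at h1
    linarith only [h1, h2, h3, h4, hlin₂]
  have hlogM : (Real.log n₁ + u * M / n₁) / (2 / η) ≤ η / 2 * Real.log n₀ + η / 2 * (C₇ * M) := by
    have h1 : u * M / n₁ ≤ C₇ * M := by
      rw [mul_div_right_comm]
      gcongr
    rw [div_div_eq_mul_div, div_le_iff₀ two_pos]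
    have h2 : (Real.log n₁ + u * M / n₁) * η ≤ (Real.log n₀ + C₇ * M) * η := by gcongr
    linarith only [h2]
  have hVQ : c ^ 2 * (Q * nextSq c ω μ) + c ^ 2 / 2 * Q ≤ V * (C₄ + C₇) := by
    have h1 : V * Q ≤ V * (C₄ + C₇) := by
      gcongr
      linarith only [hQ₁, hhalf]
    have h2 : V * Q = c ^ 2 * (Q * nextSq c ω μ) + c ^ 2 / 2 * Q := by rw [hVd]; ring
    linarith only [h1, h2]
  have hmono := mul_le_mul_of_nonneg_left
    (meanSurvival_mono c ω μ b n₁ (le_max_left N₀ n₂)) hI.le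
  rw [← hN, ← hu] at hmono
  have hlogp : p * c ^ 2 / 2 * (1 + Real.log n₁) ≤ p * c ^ 2 / 2 * (1 + Real.log n₀) := by gcongr
  linarith only [hmono, hlogp, hW, hR₁le, hcl, hlogM, hVQ, hb1, hb2, hn₁R, hI]

/-- The times before `n₁` are counted with probability at most 1. Afterwards the condition on times
before `n₁` is forgotten. -/
theorem tsum_plugInLR_lt_le {b : ℝ} {n₁ : ℕ} (hn₁ : 1 ≤ n₁) {V : ℝ}
    (hV : ∀ N : ℕ, n₁ ≤ N → n₁ + meanSurvival c ω μ b n₁ N ≤ V) :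
    ∑' n, lawChange μ 1 {x : Obs p | ∀ j ∈ Finset.Icc 1 n, plugInLR c ω j 1 x < Real.exp b}
      ≤ ENNReal.ofReal V := by
  refine ENNReal.tsum_le_of_sum_range_le fun N₀ => ?_
  have hN : n₁ ≤ max N₀ n₁ := le_max_right _ _
  refine (Finset.sum_le_sum_of_subset (Finset.range_mono (le_max_left N₀ n₁))).trans ?_
  rw [Finset.range_eq_Ico, ← Finset.sum_Ico_consecutive _ (Nat.zero_le n₁) hN]
  refine le_trans (add_le_add (b := (n₁ : ℝ≥0∞))
    (d := ENNReal.ofReal (meanSurvival c ω μ b n₁ (max N₀ n₁))) ?_ ?_) ?_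
  · refine (Finset.sum_le_card_nsmul _ _ 1 fun n _ => prob_le_one).trans ?_
    simp
  · rw [meanSurvival, ENNReal.ofReal_sum_of_nonneg fun _ _ => measureReal_nonneg]
    refine Finset.sum_le_sum fun l _ => ?_
    rw [ofReal_measureReal]
    refine measure_mono fun x hx j hj => ?_
    rw [Finset.mem_Icc] at hj
    have h1 := hx j (Finset.mem_Icc.2 ⟨hn₁.trans hj.1, hj.2⟩)
    rw [plugInLR_one_eq_exp c ω μ (hn₁.trans hj.1)] at h1
    exact Real.exp_lt_exp.1 h1
  · rw [← ENNReal.ofReal_natCast, ← ENNReal.ofReal_add n₁.cast_nonneg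
      (meanSurvival_nonneg c ω μ b _ _)]
    exact ENNReal.ofReal_le_ofReal (hV _ hN)

/-- The detection delay exceeds its approximation by less than any multiple of `log log B`. -/
theorem eventually_detectionDelay_le (hc0 : 0 ≤ c) (hc1 : c ≤ 1) (hI : 0 < infoStar c ω μ)
    {η : ℝ} (hη : 0 < η) : ∀ᶠ B : ℝ in Filter.atTop,
      detectionDelay μ (alarmTime c ω B) ≤ ENNReal.ofReal
        ((Real.log B + (p * c ^ 2 / 2) * Real.log (Real.log B)
          - (p * c ^ 2 / 2) * Real.log (infoStar c ω μ)) / infoStar c ω μ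
          + η * Real.log (Real.log B)) := by
  set I := infoStar c ω μ with hId
  -- Half of the allowance `I η log b` goes to the passage estimate; the other half absorbs the
  -- constants.
  obtain ⟨C, k, hC⟩ := exists_mul_add_meanSurvival_le c ω μ hc0 hc1 hI
    (η := I * η / 2) (by positivity)
  rw [← hId] at hC
  have hb : Filter.Tendsto Real.log Filter.atTop Filter.atTop := Real.tendsto_log_atTop
  have hll : Filter.Tendsto (fun B => Real.log (Real.log B)) Filter.atTop Filter.atTop :=
    hb.comp hb
  filter_upwards [hb.eventually_ge_atTop (I * (k + 1)), Filter.eventually_gt_atTop 0,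
    hll.eventually_ge_atTop ((C - I * η / 2 * Real.log I) / (I * η / 2))] with B hB1 hB0 hB2
  set b := Real.log B with hbd
  have hbI : (k : ℝ) + 1 ≤ b / I := by rw [le_div_iff₀ hI]; linarith
  have hbpos : 0 < b := by
    have : 0 < I * ((k : ℝ) + 1) := by positivity
    linarith
  set n₀ := ⌊b / I⌋₊ with hn₀
  have h1 : (n₀ : ℝ) ≤ b / I := Nat.floor_le (by positivity)
  have h2 : b / I < n₀ + 1 := Nat.lt_floor_add_one _
  have hk : k + 1 ≤ n₀ := Nat.le_floor (by push_cast; exact hbI)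
  have hn₀0 : (0 : ℝ) < n₀ := by exact_mod_cast (show 0 < n₀ by omega)
  rw [le_div_iff₀ hI] at h1
  obtain ⟨n₁, hn₁, hN⟩ := hC n₀ (by omega) b (by linarith)
    (by rw [div_lt_iff₀ hI] at h2; linarith)
  -- As `n₀ ≤ b / I`, this produces both the `log log B` and the `log I` correction.
  have hlog : Real.log n₀ ≤ Real.log b - Real.log I := by
    rw [← Real.log_div hbpos.ne' hI.ne']
    exact Real.log_le_log hn₀0 (by rw [le_div_iff₀ hI]; exact h1)
  refine (detectionDelay_alarmTime_le c ω μ B).trans ?_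
  have hexp : B = Real.exp b := (Real.exp_log hB0).symm
  rw [hexp]
  refine tsum_plugInLR_lt_le c ω μ hn₁ fun N hnN => ?_
  have h3 := hN N hnN
  rw [div_le_iff₀ (by positivity)] at hB2
  have h4 : (p * c ^ 2 / 2 + I * η / 2) * Real.log n₀
      ≤ (p * c ^ 2 / 2 + I * η / 2) * (Real.log b - Real.log I) := by gcongr
  have h5 : n₁ + meanSurvival c ω μ b n₁ N
      ≤ (b + (p * c ^ 2 / 2) * Real.log b - (p * c ^ 2 / 2) * Real.log I
        + I * η * Real.log b) / I := by
    rw [le_div_iff₀ hI]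
    linarith
  refine h5.trans (le_of_eq ?_)
  field_simp

end SRRS

/-! ### Assembly -/

theorem theorem3 {p : ℕ} (c : ℝ) (hc0 : 0 ≤ c) (hc1 : c ≤ 1) (ω : Fin p → ℝ) :
    (∀ B : ℝ, 0 < B → ENNReal.ofReal B ≤ SRRS.avgRunLength (SRRS.alarmTime c ω B)) ∧
    (∀ (μ : Fin p → ℝ) (I : ℝ), I = SRRS.infoNumber (SRRS.muStar c ω μ) 0 μ → 0 < I →
      ∃ r : ℝ → ℝ,
        r =o[Filter.atTop] (fun B : ℝ => (p : ℝ) * Real.log (Real.log B)) ∧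
        ∀ᶠ B : ℝ in Filter.atTop,
          SRRS.detectionDelay μ (SRRS.alarmTime c ω B) ≤
            ENNReal.ofReal
              ((Real.log B + ((p : ℝ) * c ^ 2 / 2) * Real.log (Real.log B)
                  - ((p : ℝ) * c ^ 2 / 2) * Real.log I) / I
                + r B)) := by
  refine ⟨fun B _ => SRRS.ofReal_le_avgRunLength_alarmTime c ω B, fun μ I hIe hI => ?_⟩
  rw [SRRS.infoNumber_eq] at hIe
  have hI' : 0 < SRRS.infoStar c ω μ := hIe ▸ hI
  -- Without streams the information number would be 0.
  have hp : (1 : ℝ) ≤ p := by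
    rcases Nat.eq_zero_or_pos p with rfl | h
    · simp [SRRS.infoStar] at hI'
    · exact_mod_cast h
  have hle := fun {η : ℝ} (hη : 0 < η) =>
    SRRS.eventually_detectionDelay_le c ω μ hc0 hc1 hI' hη
  rw [← hIe] at hle
  have hb : Filter.Tendsto Real.log Filter.atTop Filter.atTop := Real.tendsto_log_atTop
  have hll : Filter.Tendsto (fun B => Real.log (Real.log B)) Filter.atTop Filter.atTop :=
    hb.comp hb
  set a : ℝ → ℝ := fun B => (Real.log B + ((p : ℝ) * c ^ 2 / 2) * Real.log (Real.log B)
    - ((p : ℝ) * c ^ 2 / 2) * Real.log I) / I with ha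
  set D : ℝ → ℝ≥0∞ := fun B => SRRS.detectionDelay μ (SRRS.alarmTime c ω B) with hD
  have ha0 : ∀ᶠ B in Filter.atTop, 0 ≤ a B := by
    filter_upwards [hb.eventually_ge_atTop 0, hll.eventually_ge_atTop (Real.log I)] with B h1 h2
    have h3 : ((p : ℝ) * c ^ 2 / 2) * Real.log I ≤ ((p : ℝ) * c ^ 2 / 2) * Real.log (Real.log B) :=
      mul_le_mul_of_nonneg_left h2 (by positivity)
    exact div_nonneg (by linarith) hI.le
  -- The remainder is the actual excess of the delay over its approximation, so one function serves
  -- for every `ε` at once.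
  refine ⟨fun B => max 0 ((D B).toReal - a B), ?_, ?_⟩
  · rw [Asymptotics.isLittleO_iff]
    intro ε hε
    filter_upwards [hle hε, ha0, hll.eventually_ge_atTop 0] with B h1 h2 h3
    have h4 : 0 ≤ ε * Real.log (Real.log B) := by positivity
    have h5 : (D B).toReal ≤ a B + ε * Real.log (Real.log B) :=
      ENNReal.toReal_le_of_le_ofReal (by linarith) h1
    have h6 : Real.log (Real.log B) ≤ p * Real.log (Real.log B) := le_mul_of_one_le_left h3 hp
    rw [Real.norm_of_nonneg (le_max_left _ _), Real.norm_of_nonneg (h3.trans h6)]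
    exact max_le (by positivity) (by linarith [mul_le_mul_of_nonneg_left h6 hε.le])
  · filter_upwards [hle one_pos] with B h1
    rw [← ENNReal.ofReal_toReal (h1.trans_lt ENNReal.ofReal_lt_top).ne]
    exact ENNReal.ofReal_le_ofReal (by linarith [le_max_right 0 ((D B).toReal - a B)])
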